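/- **Setting.** Let $G$ be an $n$-dimensional torus with weight lattice $\mathbb Z_G^*$. For a compact commutative group $H$ let $R(H)$ be its representation ring, i.e. the ring of finite sums $\sum m_k\chi_k$ with $m_k\in\mathbb Z$ and $\chi_k:H\to S^1$ continuous characters. Let $\Gamma$ be a finite $d$-valent graph with vertex set $V$ and set of oriented edges $E$; for $e\in E$ let $i(e)$, $t(e)$ be its initial and terminal vertices and $\bar e$ the edge with reversed orientation. An action of $G$ on $\Gamma$ assigns to each $e\in E$ a one-dimensional representation $\varrho_e$ with character $\chi_e=e^{2\pi i\alpha_e}$, $\alpha_e\in\mathbb Z_G^*$, and to each $p\in V$ a $d$-dimensional representation $\tau_p$, such that $\tau_p\simeq\bigoplus_{i(e)=p}\varrho_e$, $\varrho_{\bar e}\simeq\varrho_e^*$ and $\tau_{i(e)}|_{G_e}\simeq\tau_{t(e)}|_{G_e}$, where $G_e=\ker\chi_e$. Assume the action is a GKM action: if $i(e_1)=i(e_2)$ and $e_1\ne e_2$, then $\alpha_{e_1},\alpha_{e_2}$ are linearly independent. Let $r_e:R(G)\to R(G_e)$ be restriction, and let $K_G(\Gamma)$ be the ring of all $f:V\to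 R(G)$ with $r_e f_{i(e)}=r_e f_{t(e)}$ for every $e\in E$. Let $T\subset G$ be a circle subgroup not contained in any $G_e$, with infinitesimal generator $\xi$ (so $\alpha_e(\xi)\in\mathbb Z$, defined by $\chi_e(\exp s\xi)=e^{2\pi i s\alpha_e(\xi)}$, is non-zero). A $T$-moment map is a function $\phi:V\to\mathbb R$ with $$\frac{\phi(t(e))-\phi(i(e))}{\alpha_e(\xi)}>0\qquad\text{for all } e\in E .$$ Let $c\in\mathbb R\setminus\phi(V)$ (a regular value of $\phi$), and let $V_c=\{e\in E:\ \phi(t(e))>c>\phi(i(e))\}$, the vertex set of the reduced hypergraph $\Gamma_c$. For $f\in K_G(\Gamma)$ and $e\in V_c$ put $$\hat f_e=f_{i(e)}\prod_{i(e')=i(e),\ e'\neq e}\bigl(1-e^{2\pi i\alpha_{e'}}\bigr)^{-1},$$ an element of the quotient ring of $R(G)$ obtained by inverting the $1-e^{2\pi i\alpha_{e'}}$. Let $\pi_e:G_e\to G/T$ be the composition of the inclusion $G_e\to G$ and the projection $G\to G/T$, and let $(\pi_e)_*:R(G_e)\to R(G/T)$ be the push-forward sending a representation of $G_e$ to its subspace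 of $\ker(\pi_e)$-invariants, regarded as a representation of $G_e/\ker\pi_e=G/T$. Extend $(\pi_e)_*$ to quotients by $(\pi_e)_*(u/\pi_e^*v)=((\pi_e)_*u)/v$, for $u\in R(G_e)$ and $v$ a non-zero-divisor of $R(G/T)$, and let $$f_c^{\#}(e)=(\pi_e)_*\,r_e\hat f_e ,$$ an element of the total quotient ring of $R(G/T)$. **Theorem.** For every $f\in K_G(\Gamma)$: 1. For every $e\in V_c$ the element $f^{\#}_c(e)$ is well defined: $\pi_e$ is surjective with finite kernel, the elements $r_e(1-e^{2\pi i\alpha_{e'}})$ with $i(e')=i(e)$, $e'\ne e$, are non-zero-divisors in $R(G_e)$, and $r_e\hat f_e$ can be written as $u/\pi_e^*v$ with $u\in R(G_e)$ and $v\in R(G/T)$ a non-zero-divisor. 2. The sum $$\chi_c(f)=\sum_{e\in V_c}f_c^{\#}(e)$$ lies in $R(G/T)$. -/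

import Mathlib

noncomputable section

namespace GraphTorus

/-! ### Representation rings of compact commutative groups -/

/-- The representation ring `R(H)` of a compact commutative group `H`: finite sums `∑ m_k χ_k`
with `m_k ∈ ℤ` and `χ_k : H → S¹` continuous characters. -/
abbrev RepRing (H : Type*) [CommGroup H] [TopologicalSpace H] : Type _ :=
  MonoidAlgebra ℤ (H →ₜ* Circle)

section RepRing

variable {H K : Type*} [CommGroup H] [TopologicalSpace H] [CommGroup K] [TopologicalSpace K]

/-- The class in `R(H)` of the one-dimensional representation with character `χ`. -/
def charClass (χ : H →ₜ* Circle) : RepRing H := MonoidAlgebra.single χ 1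

/-- The ring homomorphism `γ^* : R(K) → R(H)`, composition of representations with
`γ : H → K`. -/
def pullback (γ : H →ₜ* K) : RepRing K →+* RepRing H :=
  MonoidAlgebra.mapDomainRingHom ℤ
    { toFun := fun ψ : K →ₜ* Circle => ψ.comp γ
      map_one' := rfl
      map_mul' := fun _ _ => rfl }

open Classical in
/-- The push-forward `γ_* : R(H) → R(K)` along a surjection `γ : H → K` with finite kernel `W`:
it sends a representation `ρ` of `H` to the space `ρ^W` of `W`-invariants, as a representation of
`K = H/W`. For a one-dimensional `ρ` with character `χ` this is the character `ψ` of `K` with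
`ψ ∘ γ = χ` if `χ` is trivial on `W` (equivalently, if there is such a `ψ`, see
`exists_comp_eq_iff`), and `0` otherwise. -/
def pushforward (γ : H →ₜ* K) : RepRing H →+ RepRing K :=
  MonoidAlgebra.liftNC (Int.castAddHom (RepRing K)) fun χ =>
    if h : ∃ ψ : K →ₜ* Circle, ψ.comp γ = χ then charClass h.choose else 0

/-- `x = u / γ^* v` with `u ∈ R(H)` and `v ∈ R(K)` a non-zero-divisor. -/
def IsQuot (γ : H →ₜ* K) {S : Submonoid (RepRing H)} (x : Localization S)
    (u : RepRing H) (v : nonZeroDivisors (RepRing K)) : Prop :=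
  x * algebraMap (RepRing H) (Localization S) (pullback γ v) =
    algebraMap (RepRing H) (Localization S) u

open Classical in
/-- The extension of `γ_*` to a quotient ring `S⁻¹ R(H)`, with values in the total quotient ring
of `R(K)`: it is the `R(K)`-linear extension, `γ_* (u / γ^* v) = (γ_* u) / v`. It does not depend
on how `x` is written as `u / γ^* v`, see `pushforwardQuot_eq`. -/
def pushforwardQuot (γ : H →ₜ* K) (S : Submonoid (RepRing H)) (x : Localization S) :
    FractionRing (RepRing K) :=
  if h : ∃ p : RepRing H × nonZeroDivisors (RepRing K), IsQuot γ x p.1 p.2 then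
    IsLocalization.mk' (FractionRing (RepRing K)) (pushforward γ h.choose.1) h.choose.2
  else 0

theorem exists_comp_eq_iff [CompactSpace H] [T2Space K] {γ : H →ₜ* K}
    (hγ : Function.Surjective γ) (χ : H →ₜ* Circle) :
    (∃ ψ : K →ₜ* Circle, ψ.comp γ = χ) ↔ ∀ w : H, γ w = 1 → χ w = 1 := by
  constructor
  · rintro ⟨ψ, rfl⟩ w hw
    simp [hw]
  · intro h
    have hq : Topology.IsQuotientMap γ :=
      (γ.continuous_toFun.isClosedMap).isQuotientMap γ.continuous_toFun hγ
    let ψ : K →* Circle := MonoidHom.liftOfSurjective (γ : H →* K) hγ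
      ⟨(χ : H →* Circle), fun w hw => h w hw⟩
    have hψ : ∀ x, ψ (γ x) = χ x := fun x =>
      MonoidHom.liftOfRightInverse_comp_apply _ _ _ _ x
    refine ⟨⟨ψ, hq.continuous_iff.2 ?_⟩, ?_⟩
    · have : (fun x => ψ x) ∘ γ = χ := funext hψ
      exact this ▸ χ.continuous_toFun
    · ext x
      exact congrArg _ (hψ x)

theorem pushforward_mul_pullback {γ : H →ₜ* K} (hγ : Function.Surjective γ)
    (x : RepRing H) (y : RepRing K) :
    pushforward γ (x * pullback γ y) = pushforward γ x * y := by
  have hinj : ∀ ψ ψ' : K →ₜ* Circle, ψ.comp γ = ψ'.comp γ → ψ = ψ' := fun ψ ψ' h => by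
    ext k
    obtain ⟨a, rfl⟩ := hγ k
    exact congrArg _ (DFunLike.congr_fun h a)
  induction x using MonoidAlgebra.induction_linear with
  | zero => simp
  | add a b ha hb => rw [add_mul, map_add, ha, hb, map_add, add_mul]
  | single χ m =>
    induction y using MonoidAlgebra.induction_linear with
    | zero => simp
    | add a b ha hb => rw [map_add, mul_add, map_add, ha, hb, mul_add]
    | single ψ k =>
      have hp : pullback γ (MonoidAlgebra.single ψ k) = MonoidAlgebra.single (ψ.comp γ) k := by
        simp only [pullback, MonoidAlgebra.mapDomainRingHom_apply, MonoidAlgebra.mapDomain_single]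
        rfl
      rw [hp, MonoidAlgebra.single_mul_single]
      simp only [pushforward, MonoidAlgebra.liftNC_single]
      by_cases h : ∃ ψ' : K →ₜ* Circle, ψ'.comp γ = χ
      · obtain ⟨ψ₀, rfl⟩ := h
        have h1 : ∃ ψ' : K →ₜ* Circle, ψ'.comp γ = ψ₀.comp γ := ⟨ψ₀, rfl⟩
        have h2 : ∃ ψ' : K →ₜ* Circle, ψ'.comp γ = ψ₀.comp γ * ψ.comp γ := ⟨ψ₀ * ψ, rfl⟩
        have e1 : h1.choose = ψ₀ := hinj _ _ h1.choose_spec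
        have e2 : h2.choose = ψ₀ * ψ := hinj _ _ h2.choose_spec
        rw [dif_pos h1, dif_pos h2, e1, e2]
        have h3 : (MonoidAlgebra.single ψ k : RepRing K) = (k : RepRing K) * charClass ψ := by
          simp [charClass, ← zsmul_eq_mul, MonoidAlgebra.smul_single]
        have h4 : (charClass (ψ₀ * ψ) : RepRing K) = charClass ψ₀ * charClass ψ := by
          simp [charClass, MonoidAlgebra.single_mul_single]
        rw [h3, h4]
        simp only [Int.coe_castAddHom, Int.cast_mul]
        ring
      · have h' : ¬ ∃ ψ' : K →ₜ* Circle, ψ'.comp γ = χ * ψ.comp γ := by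
          rintro ⟨ψ', h2⟩
          refine h ⟨ψ' * ψ⁻¹, ?_⟩
          have : χ = (χ * ψ.comp γ) * (ψ.comp γ)⁻¹ := by simp
          rw [this, ← h2]
          rfl
        rw [dif_neg h, dif_neg h']
        simp

theorem pushforwardQuot_eq {γ : H →ₜ* K} (hγ : Function.Surjective γ)
    {S : Submonoid (RepRing H)} (hS : S ≤ nonZeroDivisors (RepRing H)) {x : Localization S}
    {u : RepRing H} {v : nonZeroDivisors (RepRing K)} (h : IsQuot γ x u v) :
    pushforwardQuot γ S x =
      IsLocalization.mk' (FractionRing (RepRing K)) (pushforward γ u) v := by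
  have hex : ∃ p : RepRing H × nonZeroDivisors (RepRing K), IsQuot γ x p.1 p.2 := ⟨(u, v), h⟩
  rw [pushforwardQuot, dif_pos hex]
  have h0 := hex.choose_spec
  generalize hex.choose = p at h0 ⊢
  rw [IsLocalization.mk'_eq_iff_eq]
  congr 1
  have key : u * pullback γ p.2 = p.1 * pullback γ v := by
    apply IsLocalization.injective (Localization S) hS
    rw [map_mul, map_mul]
    unfold IsQuot at h h0
    rw [← h, ← h0]
    ring
  rw [mul_comm, mul_comm _ (pushforward γ u), ← pushforward_mul_pullback hγ,
    ← pushforward_mul_pullback hγ, key]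

end RepRing

/-! ### Weights on circle subgroups -/

open MeasureTheory AddCircle in
/-- Every continuous character of the circle is a power map. -/
theorem exists_zpow (χ : Circle →ₜ* Circle) : ∃ k : ℤ, ∀ z, χ z = z ^ k := by
  have : Fact (0 < (1 : ℝ)) := ⟨one_pos⟩
  let g : C(AddCircle (1 : ℝ), ℂ) :=
    ⟨fun x => (χ x.toCircle : ℂ), by fun_prop⟩
  have hg : ∀ x, g x = (χ x.toCircle : ℂ) := fun _ => rfl
  have hadd : ∀ x y, g (x + y) = g x * g y := fun x y => by simp [hg, toCircle_add]
  have hint : ∀ n : ℤ, Integrable (fun x => fourier (-n) x • g x) haarAddCircle := fun n =>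
    (((fourier (-n)).continuous.smul g.continuous)).integrable_of_hasCompactSupport
      (HasCompactSupport.of_compactSpace _)
  have key : ∀ n : ℤ, fourierCoeff g n ≠ 0 → ∀ a, g a = fourier n a := by
    intro n hn a
    have h1 : fourierCoeff g n = fourier (-n) a * g a * fourierCoeff g n := by
      conv_lhs => rw [fourierCoeff, ← integral_add_right_eq_self _ a]
      rw [fourierCoeff, ← integral_const_mul]
      congr 1
      ext x
      rw [hadd, smul_eq_mul, smul_eq_mul]
      simp only [fourier_apply, smul_add, toCircle_add, Circle.coe_mul]
      ring
    have h2 : fourier (-n) a * g a = 1 := by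
      have := mul_right_cancel₀ hn ((one_mul _).trans h1)
      exact this.symm
    have h3 : fourier n a * fourier (-n) a = (1 : ℂ) := by
      rw [← fourier_add]; simp
    linear_combination fourier n a * h2 - g a * h3
  by_cases h : ∃ n, fourierCoeff g n ≠ 0
  · obtain ⟨n, hn⟩ := h
    refine ⟨n, fun z => ?_⟩
    obtain ⟨x, rfl⟩ : ∃ x : AddCircle (1 : ℝ), x.toCircle = z :=
      ⟨_, homeomorphCircle_apply one_ne_zero _ ▸ (homeomorphCircle one_ne_zero).apply_symm_apply z⟩
    have := key n hn x
    rw [hg, fourier_apply] at this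
    rw [← toCircle_zsmul]
    exact Circle.ext this
  · push Not at h
    have hs : Summable (fourierCoeff g) := by
      rw [show fourierCoeff g = 0 from funext h]; exact summable_zero
    have := has_pointwise_sum_fourier_series_of_summable hs 0
    simp only [h, zero_smul] at this
    have h0 := this.unique hasSum_zero
    simp [hg] at h0

/-- The integer `k` with `χ z = z ^ k` for all `z`. -/
def degree (χ : Circle →ₜ* Circle) : ℤ := (exists_zpow χ).choose

/-- The inclusion of a subgroup, as a continuous homomorphism. -/
def inclusion {G : Type*} [CommGroup G] [TopologicalSpace G] (H : Subgroup G) : H →ₜ* G where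
  toMonoidHom := H.subtype
  continuous_toFun := continuous_subtype_val

/-- The value `α(ξ)` of the weight `α` of a character `χ = e^{2πiα}` of `G` on the infinitesimal
generator `ξ` of a circle subgroup `T`. The generator is given by an identification
`ι : S¹ ≅ T`, `ι(e^{2πis}) = exp(sξ)`, so that `χ(ι(z)) = z^{α(ξ)}`. -/
def weightAt {G : Type*} [CommGroup G] [TopologicalSpace G] {T : Subgroup G}
    (ι : Circle ≃ₜ* T) (χ : G →ₜ* Circle) : ℤ :=
  degree ((χ.comp (inclusion T)).comp (ι : Circle →ₜ* T))

/-! ### Torus actions on graphs -/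

/-- A graph with vertices `V` and oriented edges `E`: `i e` and `t e` are the initial and terminal
vertices of `e`, and `bar e` is `e` with its orientation reversed. -/
structure OrientedGraph (V E : Type*) where
  i : E → V
  t : E → V
  bar : E → E
  bar_bar : ∀ e, bar (bar e) = e
  bar_ne : ∀ e, bar e ≠ e
  i_bar : ∀ e, i (bar e) = t e

/-- The one-dimensional complex representation of `G` with character `χ`. -/
def charRep {G : Type*} [CommGroup G] [TopologicalSpace G] (χ : G →ₜ* Circle) :
    Representation ℂ G ℂ where
  toFun g := LinearMap.lsmul ℂ ℂ (χ g : ℂ)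
  map_one' := by ext; simp
  map_mul' g h := by ext; simp

/-- An action of `G` on the `d`-valent graph `Γ`: one-dimensional representations `ϱ_e`, given by
their characters `χ_e`, and `d`-dimensional representations `τ_p`, such that
`τ_p ≅ ⨁_{i(e) = p} ϱ_e`, `ϱ_{bar e} ≅ ϱ_e^*` and `τ_{i(e)}` and `τ_{t(e)}` are isomorphic as
representations of `G_e = ker χ_e`. The first axiom forces `Γ` to be `d`-valent. -/
structure GraphAction (G : Type*) [CommGroup G] [TopologicalSpace G] {V E : Type*}
    (Γ : OrientedGraph V E) (d : ℕ) where
  χ : E → (G →ₜ* Circle)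
  tau : V → Representation ℂ G (Fin d → ℂ)
  tau_iso : ∀ p, Nonempty ((tau p).Equiv
    (Representation.directSum fun e : {e : E // Γ.i e = p} => charRep (χ e)))
  bar_iso : ∀ e, Nonempty ((charRep (χ (Γ.bar e))).Equiv (charRep (χ e)).dual)
  tau_restrict_iso : ∀ e, Nonempty (Representation.Equiv
    (MonoidHom.comp (tau (Γ.i e)) (χ e).toMonoidHom.ker.subtype)
    (MonoidHom.comp (tau (Γ.t e)) (χ e).toMonoidHom.ker.subtype))

/-- The vertices of the reduced hypergraph `Γ_c`: the oriented edges `e` of `Γ` with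
`φ(t(e)) > c > φ(i(e))`. -/
def OrientedGraph.reducedVertices {V E : Type*} [Fintype E] (Γ : OrientedGraph V E)
    (φ : V → ℝ) (c : ℝ) : Finset E :=
  {e : E | c < φ (Γ.t e) ∧ φ (Γ.i e) < c}

namespace GraphAction

variable {G : Type*} [CommGroup G] [TopologicalSpace G] {V E : Type*}
  {Γ : OrientedGraph V E} {d : ℕ} (A : GraphAction G Γ d)

/-- The kernel `G_e` of `χ_e`. -/
abbrev stab (e : E) : Subgroup G := (A.χ e).toMonoidHom.ker

/-- The restriction map `r_e : R(G) → R(G_e)`. -/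
def restrict (e : E) : RepRing G →+* RepRing (A.stab e) := pullback (inclusion (A.stab e))

/-- The GKM condition: weights of distinct edges with the same initial vertex are linearly
independent (over `ℤ`, in the weight lattice written as the additive group of characters; this is
the same as over `ℝ` in the dual of the Lie algebra). -/
def IsGKM : Prop :=
  ∀ e₁ e₂, Γ.i e₁ = Γ.i e₂ → e₁ = e₂ ∨
    LinearIndependent ℤ ![Additive.ofMul (A.χ e₁), Additive.ofMul (A.χ e₂)]

/-- The ring `K_G(Γ)`, a subring of the ring of all functions `V → R(G)`. -/
def KRing : Subring (V → RepRing G) where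
  carrier := {f | ∀ e, A.restrict e (f (Γ.i e)) = A.restrict e (f (Γ.t e))}
  mul_mem' hf hg e := by simp only [Pi.mul_apply, map_mul, hf e, hg e]
  one_mem' e := by simp
  add_mem' hf hg e := by simp only [Pi.add_apply, map_add, hf e, hg e]
  zero_mem' e := by simp
  neg_mem' hf e := by simp only [Pi.neg_apply, map_neg, hf e]

/-- `φ : V → ℝ` is a `T`-moment map. -/
def IsMomentMap {T : Subgroup G} (ι : Circle ≃ₜ* T) (φ : V → ℝ) : Prop :=
  ∀ e, (φ (Γ.t e) - φ (Γ.i e)) / (weightAt ι (A.χ e) : ℝ) > 0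

/-- The edges other than `e` with the same initial vertex as `e`. -/
def otherEdges (e : E) : Set E := {e' | Γ.i e' = Γ.i e ∧ e' ≠ e}

/-- The multiplicative set in `R(G)` generated by the denominators `1 - e^{2πi α_{e'}}` of
`f̂_e`. -/
def denoms (e : E) : Submonoid (RepRing G) :=
  Submonoid.closure ((fun e' => 1 - charClass (A.χ e')) '' otherEdges (Γ := Γ) e)

/-- The image in `R(G_e)` of the multiplicative set `denoms e`. -/
abbrev restrictDenoms (e : E) : Submonoid (RepRing (A.stab e)) :=
  (A.denoms e).map (A.restrict e)

open Classical in
/-- `f̂_e = f_p ∏_{e'} (1 - e^{2πi α_{e'}})⁻¹`, where `p = i(e)` and the product is over all `e'`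
with `i(e') = p` and `e' ≠ e`. -/
def fHat [Fintype E] (f : V → RepRing G) (e : E) : Localization (A.denoms e) :=
  Localization.mk (f (Γ.i e))
    ⟨∏ e' with e' ∈ otherEdges (Γ := Γ) e, (1 - charClass (A.χ e')),
      Submonoid.prod_mem _ fun e' he =>
        Submonoid.subset_closure ⟨e', (Finset.mem_filter.1 he).2, rfl⟩⟩

/-- The extension of `r_e` to the quotient ring containing `f̂_e`. -/
def restrictQuot (e : E) : Localization (A.denoms e) →+* Localization (A.restrictDenoms e) :=
  IsLocalization.map (Localization (A.restrictDenoms e)) (A.restrict e) (A.denoms e).le_comap_map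

/-- The map `π_e : G_e → G/T`. -/
def proj (T : Subgroup G) (e : E) : A.stab e →ₜ* G ⧸ T where
  toMonoidHom := (QuotientGroup.mk' T).comp (A.stab e).subtype
  continuous_toFun := continuous_quot_mk.comp continuous_subtype_val

/-- `f_c^#(e) = (π_e)_* r_e f̂_e`, in the total quotient ring of `R(G/T)`. -/
def fSharp [Fintype E] (T : Subgroup G) (f : V → RepRing G) (e : E) :
    FractionRing (RepRing (G ⧸ T)) :=
  pushforwardQuot (A.proj T e) (A.restrictDenoms e) (A.restrictQuot e (A.fHat f e))

/-- `χ_c(f) = ∑_{e ∈ V_c} f_c^#(e)`. -/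
def reducedCharacter [Fintype E] (T : Subgroup G) (φ : V → ℝ) (c : ℝ) (f : V → RepRing G) :
    FractionRing (RepRing (G ⧸ T)) :=
  ∑ e ∈ Γ.reducedVertices φ c, A.fSharp T f e

end GraphAction

end GraphTorus

end

noncomputable section

namespace GraphTorus

/-! ### Non-zero-divisors in group rings -/

/-! The proof is a residue theorem at each vertex, followed by cancellation along edges.

A circle subgroup of a torus is a direct factor, so some character `x` of `G` has weight one on `T`
(`exists_weightHom_eq`). It splits the character group and identifies `R(G)` with Laurent
polynomials in `x` over `R(G/T)`; a character `χ` of weight `w` becomes `ν(χ) x^w`. Write `α_e` also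
for the character of the edge `e`, and `m_e ≠ 0` for its weight. Then `f_p / ∏ (1 - α_e)`, over the
edges leaving `p`, is a rational function of `x`.

By the GKM condition it has partial fractions `v⁻¹ ∑ f_p g_e / (1 - α_e)` with `v` a
non-zero-divisor of `R(G/T)` (`exists_common_denominator`). On `G_e` only the `e`-th term matters,
so `f^#(e)` is `v⁻¹` times the push-forward of `r_e(f_p g_e)`. Up to the sign of `m_e`, this
push-forward is the constant term of `f_p g_e / (1 - α_e)` expanded at `x = 0` minus the one at `x =
∞` (`coeff_expand_sub_coeff_expand_inv`). Summing over `e`, the signed sum of the `f^#(e)` at `p` is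
the difference of the constant terms of `f_p / ∏ (1 - α_e)` itself. These lie in `R(G/T)`, since
each `(1 - α_e)⁻¹` expands with coefficients there (`dvd_sum_sign_smul`).

Now sum over all `p` with `φ(p) < c`. Reversing an edge preserves `f^#`, because `f` and the weights
at the two ends agree on `G_e` (`fSharp_bar`), and changes the sign of `m_e`. So edges with both
ends below `c` cancel in pairs. The edges that remain are those crossing the level `c`; they have
positive weight, and their sum is `χ_c(f)` (`reducedCharacter_eq`). -/

theorem one_sub_single_mem_nonZeroDivisors {A : Type*} [CommGroup A] {a : A}
    (ha : ∀ k : ℤ, a ^ k = 1 → k = 0) :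
    (1 - MonoidAlgebra.single a 1 : MonoidAlgebra ℤ A) ∈ nonZeroDivisors (MonoidAlgebra ℤ A) := by
  rw [mem_nonZeroDivisors_iff_left]
  intro x hx
  have hmul : MonoidAlgebra.single a (1 : ℤ) * x = x := by linear_combination -hx
  -- The coefficients of `x` are constant along the orbits of `a`. These are infinite, while the
  -- support of `x` is finite.
  have hcoeff : ∀ b, x.coeff (a * b) = x.coeff b := fun b => by
    have := congrArg (fun y : MonoidAlgebra ℤ A => y.coeff (a * b)) hmul
    simp only [MonoidAlgebra.coeff_single_mul_apply] at this
    simpa using this.symm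
  have hpow : ∀ (b : A) (k : ℕ), x.coeff (a ^ k * b) = x.coeff b := fun b k => by
    induction k with
    | zero => simp
    | succ k ih => rw [pow_succ', mul_assoc, hcoeff, ih]
  by_contra hne
  obtain ⟨b, hb⟩ : ∃ b, x.coeff b ≠ 0 := by
    by_contra! h
    exact hne (by ext b; simpa using h b)
  have hinj : Function.Injective fun k : ℕ => a ^ k * b := by
    intro k l hkl
    have h1 : a ^ k = a ^ l := mul_right_cancel hkl
    have h2 : a ^ ((k : ℤ) - l) = 1 := by
      rw [zpow_sub, zpow_natCast, zpow_natCast, h1, mul_inv_cancel]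
    have := ha _ h2
    omega
  refine Set.infinite_of_injective_forall_mem hinj (s := (x.coeff.support : Set A)) (fun k => ?_)
    (Finset.finite_toSet _)
  simpa [hpow] using hb

/-- The group elements congruent to `1` modulo an ideal of the group ring. -/
def congruentOne {M : Type*} [CommGroup M] (I : Ideal (MonoidAlgebra ℤ M)) : Subgroup M where
  carrier := {u | 1 - MonoidAlgebra.single u 1 ∈ I}
  one_mem' := by
    change 1 - MonoidAlgebra.single 1 1 ∈ I
    rw [← MonoidAlgebra.one_def, sub_self]
    exact I.zero_mem
  mul_mem' {u w} hu hw := by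
    change 1 - MonoidAlgebra.single (u * w) (1 : ℤ) ∈ I
    have h : (MonoidAlgebra.single (u * w) 1 : MonoidAlgebra ℤ M) =
        MonoidAlgebra.single u 1 * MonoidAlgebra.single w 1 := by
      simp [MonoidAlgebra.single_mul_single]
    have := I.add_mem hu (I.mul_mem_left (MonoidAlgebra.single u 1) hw)
    convert this using 1
    rw [h]
    ring
  inv_mem' {u} hu := by
    change 1 - MonoidAlgebra.single u⁻¹ (1 : ℤ) ∈ I
    have h : (MonoidAlgebra.single u⁻¹ 1 * MonoidAlgebra.single u 1 : MonoidAlgebra ℤ M) = 1 := by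
      simp [MonoidAlgebra.single_mul_single, MonoidAlgebra.one_def]
    have := I.mul_mem_left (-MonoidAlgebra.single u⁻¹ 1) hu
    convert this using 1
    linear_combination -h

/-! ### Common denominators for partial fractions -/

section PartialFractions

variable {E B : Type*} [CommRing B]

theorem mul_mem_span_pair_mul {d p q x y : B} (hx : x ∈ Ideal.span {p, d})
    (hy : y ∈ Ideal.span {q, d}) : x * y ∈ Ideal.span {p * q, d} := by
  obtain ⟨a, b, rfl⟩ := Ideal.mem_span_pair.1 hx
  obtain ⟨a', b', rfl⟩ := Ideal.mem_span_pair.1 hy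
  exact Ideal.mem_span_pair.2 ⟨a * a', a * p * b' + b * a' * q + b * b' * d, by ring⟩

/-- The analogue of "coprime to each factor implies coprime to the product", with `S` in place of
the units: `(p, d)(q, d) ⊆ (pq, d)`, and `S` is closed under products. -/
theorem exists_mem_span_prod_pair {S : Submonoid B} {D : E → B} {a : E} {s : Finset E}
    (h : ∀ e ∈ s, ∃ v ∈ S, v ∈ Ideal.span {D e, D a}) :
    ∃ v ∈ S, v ∈ Ideal.span {∏ e ∈ s, D e, D a} := by
  classical
  induction s using Finset.induction_on with
  | empty => exact ⟨1, S.one_mem, Ideal.subset_span (by simp)⟩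
  | insert b s hb ih =>
    obtain ⟨v, hv, hv'⟩ := ih fun e he => h e (Finset.mem_insert_of_mem he)
    obtain ⟨w, hw, hw'⟩ := h b (Finset.mem_insert_self b s)
    refine ⟨w * v, S.mul_mem hw hv, ?_⟩
    rw [Finset.prod_insert hb]
    exact mul_mem_span_pair_mul hw' hv'

/-- If each pair of distinct denominators generates an ideal which meets `S`, then `1 / ∏ D_e` has
a partial fraction decomposition with a common denominator in `S`. -/
theorem exists_partialFractions [DecidableEq E] {S : Submonoid B} {D : E → B} {s : Finset E}
    (hs : s.Nonempty)
    (h : ∀ e ∈ s, ∀ e' ∈ s, e ≠ e' → ∃ v ∈ S, v ∈ Ideal.span {D e, D e'}) :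
    ∃ v ∈ S, ∃ g : E → B, v = ∑ e ∈ s, g e * ∏ e' ∈ s.erase e, D e' := by
  induction hs using Finset.Nonempty.cons_induction with
  | singleton a => exact ⟨1, S.one_mem, 1, by simp⟩
  | cons a s ha hs ih =>
    obtain ⟨v, hv, g, hg⟩ := ih fun e he e' he' =>
      h e (Finset.mem_cons_of_mem he) e' (Finset.mem_cons_of_mem he')
    obtain ⟨w, hw, hw'⟩ := exists_mem_span_prod_pair (S := S) (D := D) (a := a) (s := s)
      fun e he => h e (Finset.mem_cons_of_mem he) a (Finset.mem_cons_self a s)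
        fun hea => ha (hea ▸ he)
    obtain ⟨x, y, hxy⟩ := Ideal.mem_span_pair.1 hw'
    -- With `w = x ∏_s D + y D_a`, the product `v w` is `(v x) ∏_s D + y D_a v`. Substituting the
    -- decomposition of `v` into the second term gives the coefficients `y g_e`.
    refine ⟨v * w, S.mul_mem hv hw, fun e => if e = a then v * x else y * g e, ?_⟩
    simp only [Finset.sum_cons, if_true]
    rw [Finset.cons_eq_insert, Finset.erase_insert ha]
    have hsum : ∑ e ∈ s, (if e = a then v * x else y * g e) *
        ∏ e' ∈ (insert a s).erase e, D e' = D a * y * v := by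
      rw [hg, Finset.mul_sum]
      refine Finset.sum_congr rfl fun e he => ?_
      have hea : e ≠ a := fun hea => ha (hea ▸ he)
      rw [if_neg hea, Finset.erase_insert_of_ne hea.symm, Finset.prod_insert
        fun hh => ha (Finset.mem_of_mem_erase hh)]
      ring
    rw [hsum, ← hxy]
    ring

end PartialFractions

/-! ### Laurent expansions -/

section Expansion

variable {M A : Type*} [CommGroup M] [CommGroup A]

/-- The ring homomorphism `ℤ[M] → ℤ[A]((x))` with `χ ↦ ν(χ) x^{w(χ)}`. -/
def expand (w : M →* Multiplicative ℤ) (ν : M →* A) :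
    MonoidAlgebra ℤ M →+* HahnSeries ℤ (MonoidAlgebra ℤ A) :=
  (MonoidAlgebra.lift ℤ (HahnSeries ℤ (MonoidAlgebra ℤ A)) M
    { toFun := fun χ => HahnSeries.single (w χ).toAdd (MonoidAlgebra.single (ν χ) 1)
      map_one' := by simp [← MonoidAlgebra.one_def]
      map_mul' := fun χ χ' => by
        simp [HahnSeries.single_mul_single, MonoidAlgebra.single_mul_single] }).toRingHom

theorem expand_single (w : M →* Multiplicative ℤ) (ν : M →* A) (χ : M) (k : ℤ) :
    expand w ν (MonoidAlgebra.single χ k) =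
      HahnSeries.single (w χ).toAdd (MonoidAlgebra.single (ν χ) k) := by
  have h := map_zsmul (HahnSeries.single.addMonoidHom (w χ).toAdd) k
    (MonoidAlgebra.single (ν χ) (1 : ℤ))
  rw [MonoidAlgebra.smul_single, smul_eq_mul, mul_one] at h
  have h' : expand w ν (MonoidAlgebra.single χ k) =
      k • HahnSeries.single (w χ).toAdd (MonoidAlgebra.single (ν χ) 1) := by
    simp [expand, MonoidAlgebra.lift_single, Algebra.smul_def]
  exact h'.trans h.symm

/-- Elements coming from `ℤ[A]` expand to constant series, so they factor out of every coefficient.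
-/
theorem expand_mapDomainRingHom {w : M →* Multiplicative ℤ} {ν : M →* A} {j : A →* M}
    (hw : ∀ a, w (j a) = 1) (hν : ∀ a, ν (j a) = a) (v : MonoidAlgebra ℤ A) :
    expand w ν (MonoidAlgebra.mapDomainRingHom ℤ j v) = HahnSeries.C v := by
  induction v using MonoidAlgebra.induction_linear with
  | zero => simp
  | add a b ha hb => rw [map_add, map_add, ha, hb, map_add]
  | single a k =>
    rw [MonoidAlgebra.mapDomainRingHom_apply, MonoidAlgebra.mapDomain_single]
    simp only [expand_single, hw, hν]
    rfl

/-- The expansion `∑ ± a^j x^{mj}` of `(1 - a x^m)⁻¹` in powers of `x`. -/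
def geom (m : ℤ) (a : A) : HahnSeries ℤ (MonoidAlgebra ℤ A) :=
  HahnSeries.ofSuppBddBelow
    (fun k => if m ∣ k then
      -- For `m < 0` one expands `-a⁻¹ x^{-m} (1 - a⁻¹ x^{-m})⁻¹`, which has no constant term; hence
      -- the sign and the strict inequality `0 < k`.
      (if 0 < m then (if 0 ≤ k then MonoidAlgebra.single (a ^ (k / m)) 1 else 0)
        else (if 0 < k then -MonoidAlgebra.single (a ^ (k / m)) 1 else 0)) else 0)
    ⟨0, fun k hk => by
      by_contra h
      apply hk
      have h1 : ¬ 0 ≤ k := h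
      have h2 : ¬ 0 < k := by omega
      simp [h1, h2]⟩

theorem geom_coeff (m : ℤ) (a : A) (k : ℤ) : (geom m a).coeff k = if m ∣ k then
      (if 0 < m then (if 0 ≤ k then MonoidAlgebra.single (a ^ (k / m)) 1 else 0)
        else (if 0 < k then -MonoidAlgebra.single (a ^ (k / m)) 1 else 0)) else 0 := rfl

theorem one_sub_single_mul_geom {m : ℤ} (hm : m ≠ 0) (a : A) :
    (1 - HahnSeries.single m (MonoidAlgebra.single a 1)) * geom m a = 1 := by
  ext1
  funext k
  rw [sub_mul, one_mul, HahnSeries.coeff_sub, HahnSeries.coeff_single_mul, geom_coeff, geom_coeff,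
    HahnSeries.coeff_one]
  by_cases hk : m ∣ k
  · obtain ⟨l, rfl⟩ := hk
    have h1 : m ∣ m * l - m := ⟨l - 1, by ring⟩
    have h2 : (m * l - m) / m = l - 1 := by
      rw [show m * l - m = m * (l - 1) by ring, Int.mul_ediv_cancel_left _ hm]
    have h4 : (a * a ^ (l - 1)) = a ^ l := by rw [← zpow_one_add]; congr 1; ring
    rw [if_pos h1, if_pos (dvd_mul_right m l), h2, Int.mul_ediv_cancel_left _ hm]
    have h3 : m * l = 0 ↔ l = 0 := by simp [hm]
    simp only [h3]
    by_cases hpos : 0 < m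
    · have h5 : 0 ≤ m * l ↔ 0 ≤ l := by simp [hpos]
      have h6 : 0 ≤ m * l - m ↔ 1 ≤ l := by
        rw [show m * l - m = m * (l - 1) by ring]; simp [hpos]
      simp only [hpos, if_true, h5, h6]
      rcases lt_trichotomy l 0 with h | h | h
      · simp [show ¬ 0 ≤ l by omega, show ¬ 1 ≤ l by omega, h.ne]
      · simp [h, MonoidAlgebra.one_def]
      · simp [show 0 ≤ l by omega, show 1 ≤ l by omega, h.ne', MonoidAlgebra.single_mul_single, h4]
    · have hneg : m < 0 := by omega
      have h5 : 0 < m * l ↔ l < 0 := by simp [hneg, mul_pos_iff, hpos]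
      have h6 : 0 < m * l - m ↔ l ≤ 0 := by
        rw [show m * l - m = m * (l - 1) by ring]; simp [hneg, mul_pos_iff, hpos]; omega
      simp only [hpos, if_false, h5, h6]
      rcases lt_trichotomy l 0 with h | h | h
      · simp [h, h.le, h.ne, MonoidAlgebra.single_mul_single, h4]
      · simp [h, MonoidAlgebra.one_def, MonoidAlgebra.single_mul_single]
      · simp [show ¬ l < 0 by omega, show ¬ l ≤ 0 by omega, h.ne']
  · have h1 : ¬ m ∣ k - m := fun h => hk (by simpa using dvd_add h (dvd_refl m))
    have h2 : k ≠ 0 := by rintro rfl; exact hk (dvd_zero m)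
    simp [hk, h1, h2]

/-- The expansions of `(1 - a x^m)⁻¹` at `0` and at `∞` cover complementary halves of the exponents
with opposite signs. Their difference is the two-sided series `± ∑_j a^j x^{mj}`, a formal delta
function at `a x^m = 1`. -/
theorem geom_coeff_sub_geom_neg_coeff {m : ℤ} (hm : m ≠ 0) (a : A) (k : ℤ) :
    (geom m a).coeff k - (geom (-m) a).coeff (-k) =
      if m ∣ k then m.sign • MonoidAlgebra.single (a ^ (k / m)) 1 else 0 := by
  rw [geom_coeff, geom_coeff]
  by_cases hk : m ∣ k
  · have hk' : -m ∣ -k := by simpa using hk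
    rw [if_pos hk, if_pos hk', if_pos hk, show -k / -m = k / m by rw [Int.ediv_neg,
      Int.neg_ediv_of_dvd hk, neg_neg]]
    rcases hm.lt_or_gt with h | h
    · rcases lt_or_ge 0 k with h' | h'
      · simp [h, h.not_gt, h', h'.not_ge, Int.sign_eq_neg_one_of_neg h]
      · simp [h, h.not_gt, h', h'.not_gt, Int.sign_eq_neg_one_of_neg h]
    · rcases le_or_gt 0 k with h' | h'
      · simp [h, h.not_gt, h', h'.not_gt, Int.sign_eq_one_of_pos h]
      · simp [h, h.not_gt, h', h'.not_ge, Int.sign_eq_one_of_pos h]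
  · have hk' : ¬ -m ∣ -k := by simpa using hk
    simp [hk, hk']

/-- The difference of the constant terms of the expansions of `g / (1 - a x^m)` at `0` and at `∞`
is, up to sign, the push-forward of `g`. -/
theorem coeff_expand_sub_coeff_expand_inv {w : M →* Multiplicative ℤ} {ν : M →* A}
    {P : MonoidAlgebra ℤ M →+ MonoidAlgebra ℤ A} {α : M}
    (hP : ∀ χ k, P (MonoidAlgebra.single χ k) = if (w α).toAdd ∣ (w χ).toAdd then
      MonoidAlgebra.single (ν χ * ν α ^ (-((w χ).toAdd / (w α).toAdd))) k else 0)
    (hα : (w α).toAdd ≠ 0) (g : MonoidAlgebra ℤ M) :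
    (expand w ν g * geom (w α).toAdd (ν α)).coeff 0 -
      (expand w⁻¹ ν g * geom (-(w α).toAdd) (ν α)).coeff 0 = (w α).toAdd.sign • P g := by
  induction g using MonoidAlgebra.induction_linear with
  | zero => simp
  | add a b ha hb =>
    simp only [map_add, add_mul, HahnSeries.coeff_add, smul_add, ← ha, ← hb]
    ring
  | single χ k =>
    -- Multiplying by `ν(χ) x^{w(χ)}` turns the constant term into the coefficient of the delta
    -- series at `-w(χ)`.
    rw [expand_single, expand_single, HahnSeries.coeff_single_mul, HahnSeries.coeff_single_mul,
      ← mul_sub, zero_sub, zero_sub, MonoidHom.inv_apply, toAdd_inv,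
      geom_coeff_sub_geom_neg_coeff hα, hP]
    by_cases h : (w α).toAdd ∣ (w χ).toAdd
    · rw [if_pos h, if_pos (by simpa using h), mul_smul_comm, MonoidAlgebra.single_mul_single,
        mul_one, Int.neg_ediv_of_dvd h]
    · rw [if_neg h, if_neg (by simpa using h)]
      simp

/-- The residue theorem: the sum of the push-forwards of `f ∏_{e' ≠ e} (1 - α_{e'})⁻¹`, with signs,
is integral. Here `v⁻¹ g_e` are the coefficients of a partial fraction decomposition. -/
theorem dvd_sum_sign_smul {E : Type*} [DecidableEq E] {w : M →* Multiplicative ℤ} {ν : M →* A}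
    {j : A →* M} (hw : ∀ a, w (j a) = 1) (hν : ∀ a, ν (j a) = a) {s : Finset E} {α : E → M}
    (hα : ∀ e ∈ s, (w (α e)).toAdd ≠ 0) {P : E → MonoidAlgebra ℤ M →+ MonoidAlgebra ℤ A}
    (hP : ∀ e ∈ s, ∀ χ k, P e (MonoidAlgebra.single χ k) =
      if (w (α e)).toAdd ∣ (w χ).toAdd then
        MonoidAlgebra.single (ν χ * ν (α e) ^ (-((w χ).toAdd / (w (α e)).toAdd))) k else 0)
    {v : MonoidAlgebra ℤ A} {g : E → MonoidAlgebra ℤ M}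
    (hv : MonoidAlgebra.mapDomainRingHom ℤ j v =
      ∑ e ∈ s, g e * ∏ e' ∈ s.erase e, (1 - MonoidAlgebra.single (α e') 1))
    (f : MonoidAlgebra ℤ M) :
    v ∣ ∑ e ∈ s, (w (α e)).toAdd.sign • P e (f * g e) := by
  -- The constant term of the partial fraction identity. It is used for `w`, the expansion at `x =
  -- 0`, and for `w⁻¹`, the expansion at `x = ∞`.
  have key : ∀ w' : M →* Multiplicative ℤ, (∀ a, w' (j a) = 1) →
      (∀ e ∈ s, (w' (α e)).toAdd ≠ 0) →
      v * (expand w' ν f * ∏ e ∈ s, geom (w' (α e)).toAdd (ν (α e))).coeff 0 =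
        ∑ e ∈ s, (expand w' ν (f * g e) * geom (w' (α e)).toAdd (ν (α e))).coeff 0 := by
    intro w' hw' hα'
    have hinv : ∀ e ∈ s, expand w' ν (1 - MonoidAlgebra.single (α e) 1) *
        geom (w' (α e)).toAdd (ν (α e)) = 1 := fun e he => by
      rw [map_sub, map_one, expand_single, one_sub_single_mul_geom (hα' e he)]
    have h1 : HahnSeries.C v * (expand w' ν f * ∏ e ∈ s, geom (w' (α e)).toAdd (ν (α e))) =
        ∑ e ∈ s, expand w' ν (f * g e) * geom (w' (α e)).toAdd (ν (α e)) := by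
      rw [← expand_mapDomainRingHom hw' hν, hv, map_sum, Finset.sum_mul]
      refine Finset.sum_congr rfl fun e he => ?_
      have h2 : expand w' ν (∏ e' ∈ s.erase e, (1 - MonoidAlgebra.single (α e') 1)) *
          ∏ e' ∈ s.erase e, geom (w' (α e')).toAdd (ν (α e')) = 1 := by
        rw [map_prod, ← Finset.prod_mul_distrib]
        exact Finset.prod_eq_one fun e' he' => hinv e' (Finset.mem_of_mem_erase he')
      rw [← Finset.mul_prod_erase s _ he, map_mul, map_mul]
      linear_combination expand w' ν (g e) * expand w' ν f *
        geom (w' (α e)).toAdd (ν (α e)) * h2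
    have h3 := congrArg (fun y => HahnSeries.coeff y 0) h1
    simp only [HahnSeries.coeff_sum] at h3
    rw [← h3, HahnSeries.C_mul_eq_smul, HahnSeries.coeff_smul, smul_eq_mul]
  have k1 := key w hw hα
  have k2 := key w⁻¹ (fun a => by simp [hw]) (fun e he => by simpa using hα e he)
  simp only [MonoidHom.inv_apply, toAdd_inv] at k2
  rw [← Finset.sum_congr rfl fun e he =>
    coeff_expand_sub_coeff_expand_inv (hP e he) (hα e he) (f * g e), Finset.sum_sub_distrib,
    ← k1, ← k2, ← mul_sub]
  exact dvd_mul_right _ _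

end Expansion

/-! ### Roots of unity in the circle -/

theorem circle_exp_int_mul (k : ℤ) (θ : ℝ) : Circle.exp (k * θ) = Circle.exp θ ^ k := by
  have := map_zsmul Circle.expHom k θ
  rwa [zsmul_eq_mul] at this

theorem exp_zpow_eq_one_iff {m : ℤ} (hm : m ≠ 0) (k : ℤ) :
    Circle.exp (2 * Real.pi / m) ^ k = 1 ↔ m ∣ k := by
  have hm' : (m : ℝ) ≠ 0 := by exact_mod_cast hm
  have hpi := Real.pi_ne_zero
  rw [← circle_exp_int_mul, ← Circle.exp_zero, Circle.exp_eq_exp]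
  constructor
  · rintro ⟨l, hl⟩
    refine ⟨l, ?_⟩
    have : (k : ℝ) = m * l := by
      field_simp at hl
      exact mul_right_cancel₀ (mul_ne_zero two_ne_zero hpi) (by linear_combination hl)
    exact_mod_cast this
  · rintro ⟨l, rfl⟩
    refine ⟨l, ?_⟩
    push_cast
    field_simp
    ring

theorem zpow_left_injective_circle {k l : ℤ} (h : ∀ z : Circle, z ^ k = z ^ l) : k = l := by
  -- A primitive root of unity of order greater than `|k - l|` separates the two powers.
  have h1 := (exp_zpow_eq_one_iff (m := |k - l| + 1) (by positivity) (k - l)).1 (by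
    rw [zpow_sub, h, mul_inv_cancel])
  have := Int.eq_zero_of_abs_lt_dvd h1 (by omega)
  omega

theorem exists_zpow_eq {m : ℤ} (hm : m ≠ 0) (y : Circle) : ∃ z : Circle, z ^ m = y := by
  have hm' : (m : ℝ) ≠ 0 := by exact_mod_cast hm
  refine ⟨Circle.exp (y.val.arg / m), ?_⟩
  rw [← circle_exp_int_mul, mul_div_cancel₀ _ hm']
  exact Circle.exp_arg y

theorem finite_setOf_zpow_eq_one {m : ℤ} (hm : m ≠ 0) : {z : Circle | z ^ m = 1}.Finite := by
  have hpos : 0 < m.natAbs := Int.natAbs_pos.2 hm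
  have : (Polynomial.nthRootsFinset m.natAbs (1 : ℂ) : Set ℂ).Finite := Finset.finite_toSet _
  refine (this.preimage (f := fun z : Circle => (z : ℂ)) Circle.coe_injective.injOn).subset ?_
  intro (z : Circle) (hz : z ^ m = 1)
  have hz' : z ^ m.natAbs = 1 := by
    have : z ^ (m.natAbs : ℤ) = 1 := by
      rcases Int.natAbs_eq m with h | h
      · rw [← h]; exact hz
      · rw [show (m.natAbs : ℤ) = -m by omega, zpow_neg, hz, inv_one]
    exact_mod_cast this
  simp only [Set.mem_preimage, Finset.mem_coe, Polynomial.mem_nthRootsFinset hpos]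
  rw [← Circle.coe_pow, hz', Circle.coe_one]

/-! ### Pull-back and push-forward of characters -/

section Functoriality

variable {H K L : Type*} [CommGroup H] [TopologicalSpace H] [CommGroup K] [TopologicalSpace K]
  [CommGroup L] [TopologicalSpace L]

theorem pullback_single (γ : H →ₜ* K) (ψ : K →ₜ* Circle) (k : ℤ) :
    pullback γ (MonoidAlgebra.single ψ k) = MonoidAlgebra.single (ψ.comp γ) k := by
  simp only [pullback, MonoidAlgebra.mapDomainRingHom_apply, MonoidAlgebra.mapDomain_single]
  rfl

theorem pullback_one_sub_charClass (γ : H →ₜ* K) (ψ : K →ₜ* Circle) :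
    pullback γ (1 - charClass ψ) = 1 - charClass (ψ.comp γ) := by
  rw [map_sub, map_one, charClass, pullback_single, charClass]

theorem pullback_comp (γ : H →ₜ* K) (δ : K →ₜ* L) (y : RepRing L) :
    pullback (δ.comp γ) y = pullback γ (pullback δ y) := by
  induction y using MonoidAlgebra.induction_linear with
  | zero => simp
  | add a b ha hb => simp only [map_add, ha, hb]
  | single ψ k => simp only [pullback_single]; rfl

theorem zpow_apply (χ : H →ₜ* Circle) (k : ℤ) (h : H) : (χ ^ k) h = χ h ^ k :=
  map_zpow ({ toFun := fun ψ => ψ h, map_one' := rfl, map_mul' := fun _ _ => rfl } :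
    (H →ₜ* Circle) →* Circle) χ k

theorem comp_left_injective {γ : H →ₜ* K} (hγ : Function.Surjective γ) {ψ ψ' : K →ₜ* Circle}
    (h : ψ.comp γ = ψ'.comp γ) : ψ = ψ' := by
  ext k
  obtain ⟨a, rfl⟩ := hγ k
  exact congrArg _ (DFunLike.congr_fun h a)

theorem pushforward_single_comp {γ : H →ₜ* K} (hγ : Function.Surjective γ) (ψ : K →ₜ* Circle)
    (k : ℤ) : pushforward γ (MonoidAlgebra.single (ψ.comp γ) k) = MonoidAlgebra.single ψ k := by
  have hex : ∃ ψ' : K →ₜ* Circle, ψ'.comp γ = ψ.comp γ := ⟨ψ, rfl⟩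
  have h1 : hex.choose = ψ := comp_left_injective hγ hex.choose_spec
  simp only [pushforward, MonoidAlgebra.liftNC_single]
  rw [dif_pos hex, h1]
  simp [charClass, ← zsmul_eq_mul, MonoidAlgebra.smul_single]

theorem pushforward_single_eq_zero {γ : H →ₜ* K} {χ : H →ₜ* Circle}
    (h : ¬ ∃ ψ : K →ₜ* Circle, ψ.comp γ = χ) (k : ℤ) :
    pushforward γ (MonoidAlgebra.single χ k) = 0 := by
  simp only [pushforward, MonoidAlgebra.liftNC_single]
  rw [dif_neg h, mul_zero]

end Functoriality

/-! ### Weights and the splitting of the character group -/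

theorem apply_eq_zpow_degree (χ : Circle →ₜ* Circle) (z : Circle) : χ z = z ^ degree χ :=
  (exists_zpow χ).choose_spec z

section Weights

variable {G : Type*} [CommGroup G] [TopologicalSpace G] {T : Subgroup G} (ι : Circle ≃ₜ* T)

theorem apply_eq_zpow_weightAt (χ : G →ₜ* Circle) (z : Circle) :
    χ (ι z : G) = z ^ weightAt ι χ :=
  apply_eq_zpow_degree ((χ.comp (inclusion T)).comp (ι : Circle →ₜ* T)) z

/-- The weight `χ ↦ α(ξ)` as a homomorphism. -/
def weightHom : (G →ₜ* Circle) →* Multiplicative ℤ where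
  toFun χ := Multiplicative.ofAdd (weightAt ι χ)
  map_one' := by
    rw [ofAdd_eq_one]
    exact zpow_left_injective_circle fun z => by
      rw [← apply_eq_zpow_weightAt, zpow_zero]; rfl
  map_mul' χ χ' := by
    rw [← ofAdd_add]
    congr 1
    exact zpow_left_injective_circle fun z => by
      rw [← apply_eq_zpow_weightAt, zpow_add, ← apply_eq_zpow_weightAt, ← apply_eq_zpow_weightAt]
      rfl

theorem toAdd_weightHom (χ : G →ₜ* Circle) : (weightHom ι χ).toAdd = weightAt ι χ := rfl

theorem weightHom_eq_one_iff (χ : G →ₜ* Circle) : weightHom ι χ = 1 ↔ ∀ t ∈ T, χ t = 1 := by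
  constructor
  · intro h t ht
    obtain ⟨z, hz⟩ := ι.surjective ⟨t, ht⟩
    have h1 := apply_eq_zpow_weightAt ι χ z
    rw [← toAdd_weightHom, h, toAdd_one, zpow_zero, hz] at h1
    exact h1
  · intro h
    refine Multiplicative.toAdd.injective (zpow_left_injective_circle fun z => ?_)
    rw [toAdd_weightHom, ← apply_eq_zpow_weightAt, toAdd_one, zpow_zero]
    exact h _ (ι z).2

/-- A circle subgroup of a torus is a direct factor, so it has a character of weight one. -/
theorem exists_weightHom_eq {n : ℕ} (σ : G ≃ₜ* (Fin n → Circle)) :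
    ∃ χ : G →ₜ* Circle, weightHom ι χ = Multiplicative.ofAdd 1 := by
  -- The weights form `dℤ`. The coordinates of the torus then cannot see `ι z` when `z ^ d = 1`; as
  -- they separate points, the circle has no nontrivial `d`-th root of unity, which forces `d = ±1`.
  obtain ⟨d, hd⟩ := Int.subgroup_cyclic (MonoidHom.toAdditiveLeft (weightHom ι)).range
  have hdvd : ∀ χ : G →ₜ* Circle, d ∣ weightAt ι χ := fun χ => by
    have : weightAt ι χ ∈ (MonoidHom.toAdditiveLeft (weightHom ι)).range :=
      ⟨Additive.ofMul χ, rfl⟩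
    rw [hd, AddSubgroup.mem_closure_singleton] at this
    obtain ⟨k, hk⟩ := this
    exact ⟨k, by rw [← hk, smul_eq_mul, mul_comm]⟩
  have htriv : ∀ z : Circle, z ^ d = 1 → z = 1 := by
    intro z hz
    have h1 : σ (ι z : G) = 1 := by
      funext i
      let χ : G →ₜ* Circle :=
        { toFun := fun g => σ g i
          map_one' := by simp
          map_mul' := fun _ _ => by simp
          continuous_toFun := (continuous_apply i).comp σ.continuous_toFun }
      obtain ⟨k, hk⟩ := hdvd χ
      have h2 : χ (ι z : G) = 1 := by
        rw [apply_eq_zpow_weightAt, hk, zpow_mul, hz, one_zpow]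
      exact h2
    have h2 : (ι z : G) = 1 := σ.injective (h1.trans (map_one σ).symm)
    exact ι.injective ((Subtype.ext h2).trans (map_one ι).symm)
  have hd0 : d ≠ 0 := by
    rintro rfl
    have := htriv (Circle.exp (2 * Real.pi / (2 : ℤ))) (zpow_zero _)
    have h2 := (exp_zpow_eq_one_iff two_ne_zero 1).1 (by rw [zpow_one]; exact this)
    norm_num at h2
  have hd1 : d ∣ 1 := (exp_zpow_eq_one_iff hd0 1).1 (by
    rw [zpow_one]
    exact htriv _ ((exp_zpow_eq_one_iff hd0 d).2 dvd_rfl))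
  have hmem : (1 : ℤ) ∈ (MonoidHom.toAdditiveLeft (weightHom ι)).range := by
    obtain ⟨k, hk⟩ := hd1
    rw [hd, AddSubgroup.mem_closure_singleton]
    exact ⟨k, by rw [smul_eq_mul, mul_comm, ← hk]⟩
  obtain ⟨χ, hχ⟩ := hmem
  exact ⟨χ.toMul, congrArg Multiplicative.ofAdd hχ⟩

/-- The projection `G → G/T`. -/
def quot (T : Subgroup G) : G →ₜ* G ⧸ T where
  toMonoidHom := QuotientGroup.mk' T
  continuous_toFun := continuous_quot_mk

theorem quot_surjective (T : Subgroup G) : Function.Surjective (quot T) :=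
  QuotientGroup.mk'_surjective T

theorem quot_eq_one_iff (g : G) : quot T g = 1 ↔ g ∈ T :=
  QuotientGroup.eq_one_iff g

/-- The character of `G/T` induced by a character of `G` which is trivial on `T`. -/
def descend (χ : G →ₜ* Circle) (h : ∀ t ∈ T, χ t = 1) : G ⧸ T →ₜ* Circle where
  toMonoidHom := QuotientGroup.lift T χ.toMonoidHom h
  continuous_toFun := χ.continuous_toFun.quotient_lift _

theorem descend_comp_quot (χ : G →ₜ* Circle) (h : ∀ t ∈ T, χ t = 1) :
    (descend χ h).comp (quot T) = χ := rfl

/-- The component in the characters of `G/T` of a character of `G`, with respect to the splitting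
given by a character `x` of weight one. -/
def horizontal (x : G →ₜ* Circle) (hx : weightHom ι x = Multiplicative.ofAdd 1) :
    (G →ₜ* Circle) →* (G ⧸ T →ₜ* Circle) where
  toFun χ := descend (χ * x ^ (-weightAt ι χ)) ((weightHom_eq_one_iff ι _).1 (by
    rw [map_mul, map_zpow, hx, ← ofAdd_zsmul]
    change Multiplicative.ofAdd (weightAt ι χ) * _ = 1
    rw [← ofAdd_add]
    simp))
  map_one' := by
    refine comp_left_injective (quot_surjective T) ?_
    rw [descend_comp_quot, ← toAdd_weightHom, map_one, toAdd_one]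
    simp
    rfl
  map_mul' χ χ' := by
    refine comp_left_injective (quot_surjective T) ?_
    rw [descend_comp_quot, ← toAdd_weightHom, map_mul, toAdd_mul, neg_add, zpow_add]
    change _ = (χ * x ^ (-weightAt ι χ)) * (χ' * x ^ (-weightAt ι χ'))
    rw [toAdd_weightHom, toAdd_weightHom]
    exact mul_mul_mul_comm _ _ _ _

variable {x : G →ₜ* Circle} (hx : weightHom ι x = Multiplicative.ofAdd 1)

theorem weightHom_comp_quot (ψ : G ⧸ T →ₜ* Circle) : weightHom ι (ψ.comp (quot T)) = 1 :=
  (weightHom_eq_one_iff ι _).2 fun t ht => by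
    change ψ (quot T t) = 1
    rw [(quot_eq_one_iff t).2 ht, map_one]

theorem horizontal_comp_quot_of_weightHom {χ : G →ₜ* Circle} (h : weightHom ι χ = 1) :
    (horizontal ι x hx χ).comp (quot T) = χ := by
  change χ * x ^ (-weightAt ι χ) = χ
  rw [← toAdd_weightHom, h, toAdd_one, neg_zero, zpow_zero, mul_one]

theorem horizontal_comp_quot (ψ : G ⧸ T →ₜ* Circle) :
    horizontal ι x hx (ψ.comp (quot T)) = ψ :=
  comp_left_injective (quot_surjective T)
    (horizontal_comp_quot_of_weightHom ι hx (weightHom_comp_quot ι ψ))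

/-! ### The projection of the kernel of a character -/

/-- The map `H → G/T` for a subgroup `H` of `G`. -/
def projSubgroup (T H : Subgroup G) : H →ₜ* G ⧸ T := (quot T).comp (inclusion H)

variable {α : G →ₜ* Circle} (hα : weightAt ι α ≠ 0)
include hα

theorem surjective_of_weightAt_ne_zero : Function.Surjective α := fun y => by
  obtain ⟨z, hz⟩ := exists_zpow_eq hα y
  exact ⟨ι z, by rw [apply_eq_zpow_weightAt, hz]⟩

/-- Since `α` maps `T` onto the circle, every coset of `T` can be moved along `T` until it meets
`ker α`. -/
theorem projSubgroup_ker_surjective : Function.Surjective (projSubgroup T α.toMonoidHom.ker) := by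
  intro y
  obtain ⟨g, rfl⟩ := quot_surjective T y
  obtain ⟨z, hz⟩ := exists_zpow_eq hα (α g)
  have hmem : g * (ι z : G)⁻¹ ∈ α.toMonoidHom.ker := by
    change α (g * (ι z : G)⁻¹) = 1
    rw [map_mul, map_inv, apply_eq_zpow_weightAt, hz, mul_inv_cancel]
  refine ⟨⟨_, hmem⟩, ?_⟩
  change quot T (g * (ι z : G)⁻¹) = quot T g
  rw [map_mul, map_inv, (quot_eq_one_iff _).2 (ι z).2, inv_one, mul_one]

/-- The kernel is `T ∩ ker α`, which `ι` identifies with the roots of unity of order dividing the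
weight of `α`. -/
theorem finite_ker_projSubgroup_ker :
    ((projSubgroup T α.toMonoidHom.ker).toMonoidHom.ker : Set α.toMonoidHom.ker).Finite := by
  refine ((finite_setOf_zpow_eq_one hα).image fun z => (ι z : G)).of_injOn
    (f := Subtype.val) ?_ Subtype.val_injective.injOn
  rintro ⟨g, hg⟩ hgT
  have hgT' : g ∈ T := (quot_eq_one_iff g).1 hgT
  obtain ⟨z, hz⟩ := ι.surjective ⟨g, hgT'⟩
  refine ⟨z, ?_, congrArg Subtype.val hz⟩
  change z ^ weightAt ι α = 1
  rw [← apply_eq_zpow_weightAt, hz]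
  exact hg

/-- The push-forward along `G_e → G/T` of the restriction of a character of `G`. -/
theorem pushforward_pullback_single (χ : G →ₜ* Circle) (k : ℤ) :
    pushforward (projSubgroup T α.toMonoidHom.ker)
        (pullback (inclusion α.toMonoidHom.ker) (MonoidAlgebra.single χ k)) =
      if (weightHom ι α).toAdd ∣ (weightHom ι χ).toAdd then
        MonoidAlgebra.single (horizontal ι x hx χ * horizontal ι x hx α ^
          (-((weightHom ι χ).toAdd / (weightHom ι α).toAdd))) k else 0 := by
  rw [pullback_single, toAdd_weightHom, toAdd_weightHom]
  split_ifs with h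
  · obtain ⟨l, hl⟩ := h
    rw [hl, Int.mul_ediv_cancel_left _ hα, ← map_zpow, ← map_mul,
      ← pushforward_single_comp (projSubgroup_ker_surjective ι hα)]
    congr 2
    -- The character `χ α^{-l}` agrees with `χ` on `ker α` and has weight zero, so it is the one
    -- that descends to `G/T`.
    have h1 : weightHom ι (χ * α ^ (-l)) = 1 := by
      refine Multiplicative.toAdd.injective ?_
      rw [map_mul, map_zpow, toAdd_mul, toAdd_zpow, toAdd_weightHom, toAdd_weightHom, hl]
      simp [mul_comm]
    ext g
    have h2 : horizontal ι x hx (χ * α ^ (-l)) (quot T g) = (χ * α ^ (-l)) g :=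
      DFunLike.congr_fun (horizontal_comp_quot_of_weightHom ι hx h1) (g : G)
    have h3 : (χ * α ^ (-l)) (g : G) = χ g * (α g) ^ (-l) :=
      congrArg (χ (g : G) * ·) (zpow_apply α (-l) (g : G))
    have h4 : α (g : G) = 1 := g.2
    rw [h3, h4, one_zpow, mul_one] at h2
    exact congrArg _ h2.symm
  · refine pushforward_single_eq_zero ?_ k
    rintro ⟨ψ, hψ⟩
    apply h
    -- A generator of `T ∩ ker α`; a character induced from `G/T` is trivial on it.
    set z := Circle.exp (2 * Real.pi / weightAt ι α) with hz
    have hmem : (ι z : G) ∈ α.toMonoidHom.ker := by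
      change α (ι z : G) = 1
      rw [apply_eq_zpow_weightAt, hz, exp_zpow_eq_one_iff hα]
    have h1 : ψ (quot T (ι z : G)) = χ (ι z : G) := DFunLike.congr_fun hψ ⟨_, hmem⟩
    rw [(quot_eq_one_iff _).2 (ι z).2, map_one, apply_eq_zpow_weightAt] at h1
    exact (exp_zpow_eq_one_iff hα _).1 h1.symm

/-- A character whose restriction to the kernel of `α` has finite order is linearly dependent
on `α`. -/
theorem zpow_restrict_eq_one [CompactSpace G] {β : G →ₜ* Circle}
    (h : ∀ k l : ℤ, α ^ k * β ^ l = 1 → l = 0) (k : ℤ)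
    (hk : β.comp (inclusion α.toMonoidHom.ker) ^ k = 1) : k = 0 := by
  -- Being trivial on `ker α`, the character `β ^ k` factors through `α`. A character of the circle
  -- is a power map, so `β ^ k` is a power of `α`.
  obtain ⟨ψ, hψ⟩ := (exists_comp_eq_iff (surjective_of_weightAt_ne_zero ι hα) (β ^ k)).2
    fun w hw => by
      have h1 : (β.comp (inclusion α.toMonoidHom.ker) ^ k) ⟨w, hw⟩ = 1 := by rw [hk]; rfl
      rw [zpow_apply] at h1 ⊢
      exact h1
  refine h (-degree ψ) k ?_
  ext g
  have h1 : ψ (α g) = β g ^ k := (DFunLike.congr_fun hψ g).trans (zpow_apply β k g)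
  have h2 : α g ^ (-degree ψ) * β g ^ k = 1 := by
    rw [← h1, apply_eq_zpow_degree, zpow_neg, inv_mul_cancel]
  rw [← zpow_apply, ← zpow_apply] at h2
  exact congrArg _ h2

end Weights

/-! ### Multiplicities of characters in diagonal representations -/

section Multiplicity

variable {I J S : Type*} [Fintype I] [Fintype J]

/-- An intertwiner carries the simultaneous eigenspace for `η` injectively into the one on the other
side, and the cardinalities are the dimensions of these spaces. -/
theorem card_weight_le {χ : I → S → ℂ} {ψ : J → S → ℂ} (Θ : (I → ℂ) ≃ₗ[ℂ] (J → ℂ))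
    (hΘ : ∀ s v j, Θ (fun i => χ i s * v i) j = ψ j s * Θ v j) (η : S → ℂ) :
    Nat.card {i // χ i = η} ≤ Nat.card {j // ψ j = η} := by
  classical
  let L : ({i // χ i = η} → ℂ) →ₗ[ℂ] ({j // ψ j = η} → ℂ) :=
    (LinearMap.funLeft ℂ ℂ Subtype.val) ∘ₗ Θ.toLinearMap ∘ₗ
      (Function.ExtendByZero.linearMap ℂ Subtype.val)
  have hL : Function.Injective L := by
    rw [injective_iff_map_eq_zero]
    intro v hv
    set y : I → ℂ := Function.ExtendByZero.linearMap ℂ Subtype.val v with hy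
    have hy0 : ∀ i, χ i ≠ η → y i = 0 := fun i hi =>
      Function.extend_apply' _ _ _ (by rintro ⟨a, rfl⟩; exact hi a.2)
    have hys : ∀ s j, ψ j s * Θ y j = η s * Θ y j := fun s j => by
      rw [← hΘ]
      have : (fun i => χ i s * y i) = η s • y := by
        funext i
        by_cases hi : χ i = η
        · simp [hi]
        · simp [hy0 i hi]
      rw [this, map_smul, Pi.smul_apply, smul_eq_mul]
    have hzero : Θ y = 0 := by
      funext j
      by_cases hj : ψ j = η
      · exact congrFun hv ⟨j, hj⟩
      · obtain ⟨s, hs⟩ := Function.ne_iff.1 hj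
        have h1 : (ψ j s - η s) * Θ y j = 0 := by rw [sub_mul, hys, sub_self]
        exact (mul_eq_zero.1 h1).resolve_left (sub_ne_zero.2 hs)
    have hy' : y = 0 := Θ.map_eq_zero_iff.1 hzero
    funext a
    have := congrFun hy' a.1
    rwa [hy, Function.ExtendByZero.linearMap_apply, Subtype.val_injective.extend_apply] at this
  simpa [Nat.card_eq_fintype_card] using LinearMap.finrank_le_finrank_of_injective hL

theorem card_weight_eq {χ : I → S → ℂ} {ψ : J → S → ℂ} (Θ : (I → ℂ) ≃ₗ[ℂ] (J → ℂ))
    (hΘ : ∀ s v j, Θ (fun i => χ i s * v i) j = ψ j s * Θ v j) (η : S → ℂ) :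
    Nat.card {i // χ i = η} = Nat.card {j // ψ j = η} := by
  refine (card_weight_le Θ hΘ η).antisymm (card_weight_le Θ.symm (fun s v i => ?_) η)
  have h : (fun j => ψ j s * v j) = Θ (fun i => χ i s * Θ.symm v i) := by
    funext j
    rw [hΘ, Θ.apply_symm_apply]
  rw [h, Θ.symm_apply_apply]

end Multiplicity

/-! ### Graph actions -/

open Classical in
/-- The edges with initial vertex `p`. -/
def OrientedGraph.outEdges {V E : Type*} [Fintype E] (Γ : OrientedGraph V E) (p : V) : Finset E :=
  {e : E | Γ.i e = p}

theorem OrientedGraph.mem_outEdges {V E : Type*} [Fintype E] {Γ : OrientedGraph V E} {p : V}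
    {e : E} : e ∈ Γ.outEdges p ↔ Γ.i e = p := by
  simp [OrientedGraph.outEdges]

/-- `G_e` and the stabilizer of the reversed edge are equal but not definitionally so. This lemma
and the next move statements between their representation rings. -/
theorem pullback_inclusion_eq_iff {G : Type*} [CommGroup G] [TopologicalSpace G]
    {H H' : Subgroup G} (h : H = H') (a b : RepRing G) :
    pullback (inclusion H) a = pullback (inclusion H) b ↔
      pullback (inclusion H') a = pullback (inclusion H') b := by
  subst h
  rfl

theorem pushforward_pullback_inclusion_congr {G : Type*} [CommGroup G] [TopologicalSpace G]
    (T : Subgroup G) {H H' : Subgroup G} (h : H = H') (a : RepRing G) :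
    pushforward (projSubgroup T H) (pullback (inclusion H) a) =
      pushforward (projSubgroup T H') (pullback (inclusion H') a) := by
  subst h
  rfl

namespace GraphAction

variable {G : Type*} [CommGroup G] [TopologicalSpace G] {V E : Type*}
  {Γ : OrientedGraph V E} {d : ℕ} (A : GraphAction G Γ d)

/-- Evaluate the intertwining relation on `1`, where the isomorphism does not vanish, and compare
eigenvalues. -/
theorem χ_bar (e : E) : A.χ (Γ.bar e) = (A.χ e)⁻¹ := by
  obtain ⟨Φ⟩ := A.bar_iso e
  have hne : Φ.toLinearEquiv (1 : ℂ) (1 : ℂ) ≠ 0 := fun h => by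
    have h0 : Φ.toLinearEquiv (1 : ℂ) = 0 := LinearMap.ext_ring (by simpa using h)
    exact one_ne_zero (Φ.toLinearEquiv.map_eq_zero_iff.1 h0)
  ext g
  have h1 := LinearMap.congr_fun (LinearMap.congr_fun (Φ.isIntertwining' g) (1 : ℂ)) (1 : ℂ)
  have h2 : Φ.toLinearEquiv ((A.χ (Γ.bar e) g : ℂ) • (1 : ℂ)) (1 : ℂ) =
      Φ.toLinearEquiv (1 : ℂ) ((A.χ e g⁻¹ : ℂ) • (1 : ℂ)) := h1
  rw [map_smul, map_smul, LinearMap.smul_apply, smul_eq_mul, smul_eq_mul] at h2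
  have h3 := mul_right_cancel₀ hne h2
  rw [h3, map_inv]
  rfl

theorem stab_bar (e : E) : A.stab (Γ.bar e) = A.stab e := by
  ext g
  change A.χ (Γ.bar e) g = 1 ↔ A.χ e g = 1
  rw [χ_bar]
  exact inv_eq_one

theorem restrict_eq_iff_bar (e : E) (a b : RepRing G) :
    A.restrict (Γ.bar e) a = A.restrict (Γ.bar e) b ↔ A.restrict e a = A.restrict e b :=
  pullback_inclusion_eq_iff (A.stab_bar e) a b

theorem restrict_charClass_self (e : E) : A.restrict e (1 - charClass (A.χ e)) = 0 := by
  rw [restrict, pullback_one_sub_charClass, sub_eq_zero]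
  have : (A.χ e).comp (inclusion (A.stab e)) = 1 := by
    ext g
    exact congrArg _ g.2
  rw [this]
  rfl

section Fintype

variable [Fintype E]

/-- The weights at the end points of `e` agree on `G_e`, with multiplicities. -/
theorem map_restrict_outEdges (e : E) :
    (Γ.outEdges (Γ.i e)).val.map (fun e' => (A.χ e').comp (inclusion (A.stab e))) =
      (Γ.outEdges (Γ.t e)).val.map (fun e' => (A.χ e').comp (inclusion (A.stab e))) := by
  classical
  obtain ⟨Φ⟩ := A.tau_iso (Γ.i e)
  obtain ⟨Ψ⟩ := A.tau_iso (Γ.t e)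
  obtain ⟨Ω⟩ := A.tau_restrict_iso e
  let Θ₀ := Φ.toLinearEquiv.symm ≪≫ₗ Ω.toLinearEquiv ≪≫ₗ Ψ.toLinearEquiv
  have hΘ₀ : ∀ (g : A.stab e) y,
      Θ₀ (Representation.directSum (fun e' : {e' // Γ.i e' = Γ.i e} => charRep (A.χ e')) g y) =
      Representation.directSum (fun e' : {e' // Γ.i e' = Γ.t e} => charRep (A.χ e')) g (Θ₀ y) := by
    intro g y
    have h1 : Φ.toLinearEquiv.symm (Representation.directSum
        (fun e' : {e' // Γ.i e' = Γ.i e} => charRep (A.χ e')) g y) =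
        A.tau (Γ.i e) g (Φ.toLinearEquiv.symm y) := by
      rw [LinearEquiv.symm_apply_eq]
      have := LinearMap.congr_fun (Φ.isIntertwining' (g : G)) (Φ.toLinearEquiv.symm y)
      refine Eq.trans ?_ this.symm
      exact congrArg _ (Φ.toLinearEquiv.apply_symm_apply y).symm
    have h2 := LinearMap.congr_fun (Ω.isIntertwining' g) (Φ.toLinearEquiv.symm y)
    have h3 := LinearMap.congr_fun (Ψ.isIntertwining' (g : G))
      (Ω.toLinearEquiv (Φ.toLinearEquiv.symm y))
    change Ψ.toLinearEquiv (Ω.toLinearEquiv (Φ.toLinearEquiv.symm _)) = _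
    rw [h1]
    exact (congrArg Ψ.toLinearEquiv h2).trans h3
  -- The composite isomorphism in coordinates, where both actions of `G_e` are diagonal and
  -- multiplicities can be compared.
  let Θ : ({e' // Γ.i e' = Γ.i e} → ℂ) ≃ₗ[ℂ] ({e' // Γ.i e' = Γ.t e} → ℂ) :=
    (DirectSum.linearEquivFunOnFintype ℂ _ (fun _ => ℂ)).symm ≪≫ₗ Θ₀ ≪≫ₗ
      DirectSum.linearEquivFunOnFintype ℂ _ (fun _ => ℂ)
  have hΘ : ∀ (g : A.stab e) (y : {e' // Γ.i e' = Γ.i e} → ℂ) j,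
      Θ (fun i => (A.χ i.1 g : ℂ) * y i) j = (A.χ j.1 g : ℂ) * Θ y j := by
    intro g y j
    have h1 : (DirectSum.linearEquivFunOnFintype ℂ _ (fun _ => ℂ)).symm
        (fun i : {e' // Γ.i e' = Γ.i e} => (A.χ i.1 g : ℂ) * y i) =
        Representation.directSum (fun e' : {e' // Γ.i e' = Γ.i e} => charRep (A.χ e')) g
          ((DirectSum.linearEquivFunOnFintype ℂ _ (fun _ => ℂ)).symm y) := by
      rw [LinearEquiv.symm_apply_eq]
      funext i
      have h4 : y i = (DirectSum.linearEquivFunOnFintype ℂ _ (fun _ => ℂ)).symm y i := by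
        conv_lhs => rw [← (DirectSum.linearEquivFunOnFintype ℂ
          {e' // Γ.i e' = Γ.i e} (fun _ => ℂ)).apply_symm_apply y]
        rfl
      rw [h4]
      rfl
    exact (congrArg (fun y' => DirectSum.linearEquivFunOnFintype ℂ _ (fun _ => ℂ) (Θ₀ y') j)
      h1).trans (congrArg (fun y' => DirectSum.linearEquivFunOnFintype ℂ _ (fun _ => ℂ) y' j)
        (hΘ₀ g _))
  have hcount := card_weight_eq (χ := fun (i : {e' // Γ.i e' = Γ.i e}) (g : A.stab e) =>
    (A.χ i.1 g : ℂ)) (ψ := fun (j : {e' // Γ.i e' = Γ.t e}) (g : A.stab e) => (A.χ j.1 g : ℂ)) Θ hΘ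
  have hcard : ∀ (p : V) (η : A.stab e →ₜ* Circle),
      ((Γ.outEdges p).val.map (fun e' => (A.χ e').comp (inclusion (A.stab e)))).count η =
        Nat.card {i : {e' // Γ.i e' = p} //
          (fun g : A.stab e => (A.χ i.1 g : ℂ)) = fun g => (η g : ℂ)} := by
    intro p η
    rw [Multiset.count_map, ← Finset.filter_val, Finset.card_val]
    refine Eq.trans (Nat.subtype_card _ fun e' => ?_).symm (Nat.card_congr
      (Equiv.subtypeSubtypeEquivSubtypeInter (fun e' => Γ.i e' = p) fun e' =>
        (fun g : A.stab e => (A.χ e' g : ℂ)) = fun g => (η g : ℂ)).symm)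
    rw [Finset.mem_filter, OrientedGraph.mem_outEdges]
    refine and_congr_right fun _ => ⟨?_, fun h => ?_⟩
    · rintro rfl
      rfl
    · ext g
      exact (congrFun h g).symm
  exact Multiset.ext.2 fun η => by rw [hcard, hcard, hcount]

/-- The two multisets of restricted weights agree, and `e` and its reversal both contribute the
trivial character of `G_e`; removing it from each side leaves equal multisets. -/
theorem restrict_prod_erase_bar [DecidableEq E] (e : E) :
    A.restrict e (∏ e' ∈ (Γ.outEdges (Γ.i e)).erase e, (1 - charClass (A.χ e'))) =
      A.restrict e (∏ e' ∈ (Γ.outEdges (Γ.t e)).erase (Γ.bar e), (1 - charClass (A.χ e'))) := by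
  classical
  have hprod : ∀ s : Finset E, A.restrict e (∏ e' ∈ s, (1 - charClass (A.χ e'))) =
      ((s.val.map fun e' => (A.χ e').comp (inclusion (A.stab e))).map
        fun η => (1 - charClass η)).prod := fun s => by
    rw [map_prod, Multiset.map_map]
    exact congrArg Multiset.prod (Multiset.map_congr rfl fun e' _ =>
      pullback_one_sub_charClass _ _)
  have hbar : (A.χ (Γ.bar e)).comp (inclusion (A.stab e)) =
      (A.χ e).comp (inclusion (A.stab e)) := by
    ext g
    have h1 : A.χ e (g : G) = 1 := g.2
    have h2 : A.χ (Γ.bar e) (g : G) = 1 := (A.stab_bar e).ge g.2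
    exact congrArg _ (h2.trans h1.symm)
  rw [hprod, hprod, Finset.erase_val, Finset.erase_val,
    Multiset.map_erase_of_mem _ _ (OrientedGraph.mem_outEdges.2 rfl),
    Multiset.map_erase_of_mem _ _ (OrientedGraph.mem_outEdges.2 (Γ.i_bar e)), hbar,
    map_restrict_outEdges]

theorem fHat_eq [DecidableEq E] (f : V → RepRing G) (e : E) :
    A.fHat f e = Localization.mk (f (Γ.i e))
      (⟨∏ e' ∈ (Γ.outEdges (Γ.i e)).erase e, (1 - charClass (A.χ e')),
        Submonoid.prod_mem _ fun e' he => Submonoid.subset_closure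
          ⟨e', ⟨OrientedGraph.mem_outEdges.1 (Finset.mem_of_mem_erase he),
            Finset.ne_of_mem_erase he⟩, rfl⟩⟩ : A.denoms e) := by
  rw [fHat]
  congr 2
  refine Finset.prod_congr ?_ fun _ _ => rfl
  ext e'
  classical
  rw [Finset.mem_filter, Finset.mem_erase, OrientedGraph.mem_outEdges]
  simp [otherEdges, and_comm]

/-- The value of `f_c^#(e)` computed from a representation `r_e f̂_e = r_e u / π_e^* v`. -/
theorem isQuot_and_fSharp_eq [DecidableEq E] {T : Subgroup G} {f : V → RepRing G} {e : E}
    (hS : A.restrictDenoms e ≤ nonZeroDivisors (RepRing (A.stab e)))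
    (hsurj : Function.Surjective (A.proj T e)) {u : RepRing G}
    (v : nonZeroDivisors (RepRing (G ⧸ T)))
    (h : A.restrict e (f (Γ.i e) * pullback (quot T) v) = A.restrict e
      (u * ∏ e' ∈ (Γ.outEdges (Γ.i e)).erase e, (1 - charClass (A.χ e')))) :
    IsQuot (A.proj T e) (A.restrictQuot e (A.fHat f e)) (A.restrict e u) v ∧
      A.fSharp T f e = IsLocalization.mk' (FractionRing (RepRing (G ⧸ T)))
        (pushforward (projSubgroup T (A.stab e)) (A.restrict e u)) v := by
  have hq : IsQuot (A.proj T e) (A.restrictQuot e (A.fHat f e)) (A.restrict e u) v := by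
    rw [IsQuot, fHat_eq, Localization.mk_eq_mk', restrictQuot, IsLocalization.map_mk',
      mul_comm, IsLocalization.mul_mk'_eq_mk'_of_mul]
    refine IsLocalization.mk'_eq_iff_eq_mul.2 ?_
    rw [← map_mul]
    congr 1
    have h1 : pullback (A.proj T e) v = A.restrict e (pullback (quot T) v) :=
      pullback_comp (inclusion (A.stab e)) (quot T) _
    rw [h1, ← map_mul, ← map_mul, mul_comm, h]
  exact ⟨hq, pushforwardQuot_eq hsurj hS hq⟩

theorem fSharp_bar {T : Subgroup G} {f : V → RepRing G} (hf : f ∈ A.KRing)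
    (hS : ∀ e, A.restrictDenoms e ≤ nonZeroDivisors (RepRing (A.stab e)))
    (hsurj : ∀ e, Function.Surjective (A.proj T e)) [DecidableEq E] {e : E} {u : RepRing G}
    (v : nonZeroDivisors (RepRing (G ⧸ T)))
    (h : A.restrict e (f (Γ.i e) * pullback (quot T) v) = A.restrict e
      (u * ∏ e' ∈ (Γ.outEdges (Γ.i e)).erase e, (1 - charClass (A.χ e')))) :
    A.fSharp T f (Γ.bar e) = A.fSharp T f e := by
  rw [(A.isQuot_and_fSharp_eq (hS e) (hsurj e) v h).2,
    -- The same `u` and `v` serve at the reversed edge, because numerators and denominators at the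
    -- two ends agree on `G_e`.
    (A.isQuot_and_fSharp_eq (hS _) (hsurj _) v (u := u) ?_).2]
  · congr 1
    exact pushforward_pullback_inclusion_congr T (A.stab_bar e) u
  · rw [restrict_eq_iff_bar, Γ.i_bar, map_mul, map_mul, ← restrict_prod_erase_bar, ← hf e,
      ← map_mul, ← map_mul, h]

end Fintype

end GraphAction

/-! ### Consequences of the GKM condition: integrality at a vertex and cancellation along edges -/

namespace GraphAction

variable {G : Type*} [CommGroup G] [TopologicalSpace G] {V E : Type*}
  {Γ : OrientedGraph V E} {d : ℕ} {A : GraphAction G Γ d}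

theorem IsGKM.eq_zero_and_eq_zero (hA : A.IsGKM) {e e' : E} (hi : Γ.i e = Γ.i e') (hne : e ≠ e')
    {k l : ℤ} (h : A.χ e ^ k * A.χ e' ^ l = 1) : k = 0 ∧ l = 0 :=
  LinearIndependent.pair_iff.1 ((hA e e' hi).resolve_left hne) k l
    (congrArg Additive.ofMul h)

variable {T : Subgroup G} (ι : Circle ≃ₜ* T)

theorem weightAt_ne_zero (hT : ∀ e, ¬ T ≤ A.stab e) (e : E) : weightAt ι (A.χ e) ≠ 0 := fun h =>
  hT e fun t ht => (weightHom_eq_one_iff ι (A.χ e)).1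
    (Multiplicative.toAdd.injective h) t ht

variable (hw : ∀ e, weightAt ι (A.χ e) ≠ 0)
include hw

theorem restrictDenoms_le_nonZeroDivisors [CompactSpace G] (hA : A.IsGKM) (e : E) :
    A.restrictDenoms e ≤ nonZeroDivisors (RepRing (A.stab e)) := by
  rw [restrictDenoms, Submonoid.map_le_iff_le_comap, denoms, Submonoid.closure_le]
  rintro _ ⟨e', ⟨hi, hne⟩, rfl⟩
  change A.restrict e (1 - charClass (A.χ e')) ∈ nonZeroDivisors (RepRing (A.stab e))
  rw [restrict, pullback_one_sub_charClass]
  exact one_sub_single_mem_nonZeroDivisors fun k hk =>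
    zpow_restrict_eq_one ι (hw e) (fun a b hab =>
      (hA.eq_zero_and_eq_zero hi.symm hne.symm hab).2) k hk

/-- The denominators at two distinct edges with the same initial vertex generate an ideal which
contains a non-zero-divisor of `R(G/T)`. -/
theorem exists_mem_span_pair (hA : A.IsGKM) {x : G →ₜ* Circle}
    (hx : weightHom ι x = Multiplicative.ofAdd 1) {e e' : E} (hi : Γ.i e = Γ.i e') (hne : e ≠ e') :
    ∃ v ∈ (nonZeroDivisors (RepRing (G ⧸ T))).map (pullback (quot T)),
      v ∈ Ideal.span {1 - charClass (A.χ e), 1 - charClass (A.χ e')} := by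
  set m := weightAt ι (A.χ e) with hm
  set m' := weightAt ι (A.χ e') with hm'
  -- The exponents make the weight zero, so `β` comes from `G/T`. It has infinite order by linear
  -- independence, and `1 - β` lies in the ideal since both characters are `1` modulo it.
  set β := A.χ e ^ m' * A.χ e' ^ (-m) with hβ
  have hβw : weightHom ι β = 1 := by
    refine Multiplicative.toAdd.injective ?_
    rw [hβ, map_mul, map_zpow, map_zpow, toAdd_mul, toAdd_zpow, toAdd_zpow, toAdd_weightHom,
      toAdd_weightHom, ← hm, ← hm']
    simp [mul_comm]
  have hβj := horizontal_comp_quot_of_weightHom ι hx hβw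
  refine ⟨pullback (quot T) (1 - charClass (horizontal ι x hx β)),
    Submonoid.mem_map_of_mem _ (one_sub_single_mem_nonZeroDivisors fun k hk => ?_), ?_⟩
  · have h1 : β ^ k = 1 := by
      ext g
      have h2 : (horizontal ι x hx β ^ k) (quot T g) = 1 := by rw [hk]; rfl
      have h3 : horizontal ι x hx β (quot T g) = β g := DFunLike.congr_fun hβj g
      rw [zpow_apply, h3, ← zpow_apply] at h2
      exact congrArg _ h2
    rw [hβ, mul_zpow, ← zpow_mul, ← zpow_mul] at h1
    have h4 := (hA.eq_zero_and_eq_zero hi hne h1).1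
    exact (mul_eq_zero.1 h4).resolve_left (hw e')
  · rw [pullback_one_sub_charClass, hβj]
    set I : Ideal (RepRing G) := Ideal.span {1 - charClass (A.χ e), 1 - charClass (A.χ e')}
    have h1 : A.χ e ∈ congruentOne I := Ideal.subset_span (Set.mem_insert _ _)
    have h2 : A.χ e' ∈ congruentOne I := Ideal.subset_span (Set.mem_insert_of_mem _ rfl)
    exact (congruentOne I).mul_mem ((congruentOne I).zpow_mem h1 _)
      ((congruentOne I).zpow_mem h2 _)

variable [Fintype E]

theorem exists_common_denominator [DecidableEq E] (hA : A.IsGKM) {x : G →ₜ* Circle}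
    (hx : weightHom ι x = Multiplicative.ofAdd 1) {p : V} (hp : (Γ.outEdges p).Nonempty) :
    ∃ (v : nonZeroDivisors (RepRing (G ⧸ T))) (g : E → RepRing G), pullback (quot T) v =
      ∑ e ∈ Γ.outEdges p, g e * ∏ e' ∈ (Γ.outEdges p).erase e, (1 - charClass (A.χ e')) := by
  obtain ⟨_, ⟨v, hv, rfl⟩, g, hg⟩ := exists_partialFractions
    (D := fun e => 1 - charClass (A.χ e)) hp fun e he e' he' hne =>
      exists_mem_span_pair ι hw hA hx ((OrientedGraph.mem_outEdges.1 he).trans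
        (OrientedGraph.mem_outEdges.1 he').symm) hne
  exact ⟨⟨v, hv⟩, g, hg⟩

omit hw in
-- Every term of the decomposition other than the `e`-th contains the factor `1 - α_e`, which
-- vanishes on `G_e`.
theorem restrict_mul_eq_of_partialFractions [DecidableEq E] {e : E} {y : RepRing G}
    {g : E → RepRing G} (hy : y = ∑ e' ∈ Γ.outEdges (Γ.i e),
      g e' * ∏ e'' ∈ (Γ.outEdges (Γ.i e)).erase e', (1 - charClass (A.χ e''))) (a : RepRing G) :
    A.restrict e (a * y) = A.restrict e
      (a * g e * ∏ e' ∈ (Γ.outEdges (Γ.i e)).erase e, (1 - charClass (A.χ e'))) := by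
  have he : e ∈ Γ.outEdges (Γ.i e) := OrientedGraph.mem_outEdges.2 rfl
  rw [hy, mul_assoc, map_mul, map_mul, map_sum, Finset.sum_eq_single_of_mem e he]
  intro e' he' hne
  rw [← Finset.mul_prod_erase _ _ (Finset.mem_erase.2 ⟨hne.symm, he⟩), map_mul, map_mul,
    restrict_charClass_self, zero_mul, mul_zero]

/-- The signed sum of `f_c^#(e)` over all edges with a given initial vertex lies in `R(G/T)`. -/
theorem exists_algebraMap_eq_sum_outEdges [CompactSpace G] (hA : A.IsGKM) {x : G →ₜ* Circle}
    (hx : weightHom ι x = Multiplicative.ofAdd 1) (f : V → RepRing G) (p : V) :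
    ∃ F : RepRing (G ⧸ T), algebraMap _ (FractionRing (RepRing (G ⧸ T))) F =
      ∑ e ∈ Γ.outEdges p, (weightAt ι (A.χ e)).sign • A.fSharp T f e := by
  classical
  rcases (Γ.outEdges p).eq_empty_or_nonempty with hp | hp
  · exact ⟨0, by simp [hp]⟩
  obtain ⟨v, g, hg⟩ := exists_common_denominator ι hw hA hx hp
  have hval : ∀ e ∈ Γ.outEdges p, A.fSharp T f e =
      IsLocalization.mk' (FractionRing (RepRing (G ⧸ T)))
        (pushforward (projSubgroup T (A.stab e)) (A.restrict e (f p * g e))) v := by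
    intro e he
    obtain rfl := OrientedGraph.mem_outEdges.1 he
    exact (A.isQuot_and_fSharp_eq (restrictDenoms_le_nonZeroDivisors ι hw hA e)
      (projSubgroup_ker_surjective ι (hw e)) v (restrict_mul_eq_of_partialFractions hg _)).2
  -- All the `f^#(e)` at `p` share the denominator `v`, so integrality of their signed sum amounts
  -- to `v` dividing the signed sum of numerators.
  obtain ⟨F, hF⟩ := dvd_sum_sign_smul (w := weightHom ι) (ν := horizontal ι x hx)
    (j := { toFun := fun ψ : G ⧸ T →ₜ* Circle => ψ.comp (quot T)
            map_one' := rfl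
            map_mul' := fun _ _ => rfl })
    (weightHom_comp_quot ι) (horizontal_comp_quot ι hx) (s := Γ.outEdges p) (α := A.χ)
    (fun e _ => hw e)
    (P := fun e => (pushforward (projSubgroup T (A.stab e))).comp
      (A.restrict e : RepRing G →+ RepRing (A.stab e)))
    (fun e _ χ k => pushforward_pullback_single ι hx (hw e) χ k) hg (f p)
  refine ⟨F, ?_⟩
  have hsum : ∑ e ∈ Γ.outEdges p, (weightAt ι (A.χ e)).sign • A.fSharp T f e =
      IsLocalization.mk' (FractionRing (RepRing (G ⧸ T))) ((v : RepRing (G ⧸ T)) * F) v := by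
    rw [← hF, IsLocalization.eq_mk'_iff_mul_eq, Finset.sum_mul, map_sum]
    refine Finset.sum_congr rfl fun e he => ?_
    rw [hval e he, smul_mul_assoc, IsLocalization.mk'_spec, map_zsmul]
    rfl
  rw [hsum, mul_comm, IsLocalization.mk'_mul_cancel_right]

omit [Fintype E] hw in
theorem IsMomentMap.sign_weightAt {φ : V → ℝ} (hφ : A.IsMomentMap ι φ) {e : E}
    (h : φ (Γ.i e) < φ (Γ.t e)) : (weightAt ι (A.χ e)).sign = 1 := by
  refine Int.sign_eq_one_of_pos ?_
  have h1 := (div_pos_iff_of_pos_left (sub_pos.2 h)).1 (hφ e)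
  exact_mod_cast h1

/-- Reversing an edge negates its weight and leaves `f^#` unchanged. -/
theorem sign_smul_fSharp_add_bar [CompactSpace G] (hA : A.IsGKM) {x : G →ₜ* Circle}
    (hx : weightHom ι x = Multiplicative.ofAdd 1) {f : V → RepRing G} (hf : f ∈ A.KRing) (e : E) :
    (weightAt ι (A.χ e)).sign • A.fSharp T f e +
      (weightAt ι (A.χ (Γ.bar e))).sign • A.fSharp T f (Γ.bar e) = 0 := by
  classical
  have he : e ∈ Γ.outEdges (Γ.i e) := OrientedGraph.mem_outEdges.2 rfl
  obtain ⟨v, g, hg⟩ := exists_common_denominator ι hw hA hx ⟨e, he⟩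
  have hwbar : weightAt ι (A.χ (Γ.bar e)) = -weightAt ι (A.χ e) := by
    rw [χ_bar, ← toAdd_weightHom, map_inv, toAdd_inv, toAdd_weightHom]
  rw [A.fSharp_bar hf (restrictDenoms_le_nonZeroDivisors ι hw hA)
    (fun e => projSubgroup_ker_surjective ι (hw e)) v
    (restrict_mul_eq_of_partialFractions hg _), hwbar, Int.sign_neg, neg_smul, add_neg_cancel]

theorem reducedCharacter_eq [CompactSpace G] [Fintype V] (hA : A.IsGKM) {x : G →ₜ* Circle}
    (hx : weightHom ι x = Multiplicative.ofAdd 1) {φ : V → ℝ} (hφ : A.IsMomentMap ι φ) {c : ℝ}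
    (hc : c ∉ Set.range φ) {f : V → RepRing G} (hf : f ∈ A.KRing) :
    A.reducedCharacter T φ c f = ∑ p with φ p < c, ∑ e ∈ Γ.outEdges p,
      (weightAt ι (A.χ e)).sign • A.fSharp T f e := by
  classical
  have h1 : ∑ p with φ p < c, ∑ e ∈ Γ.outEdges p,
      (weightAt ι (A.χ e)).sign • A.fSharp T f e =
      ∑ e with φ (Γ.i e) < c, (weightAt ι (A.χ e)).sign • A.fSharp T f e := by
    rw [← Finset.sum_fiberwise_of_maps_to (s := {e : E | φ (Γ.i e) < c}) (t := {p | φ p < c})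
      (g := Γ.i) (by simp)]
    refine Finset.sum_congr rfl fun p hp => Finset.sum_congr ?_ fun _ _ => rfl
    ext e
    simp only [Finset.mem_filter, Finset.mem_univ, true_and, OrientedGraph.mem_outEdges] at hp ⊢
    exact ⟨fun h => ⟨h ▸ hp, h⟩, fun h => h.2⟩
  rw [h1, ← Finset.sum_filter_add_sum_filter_not _ fun e => c < φ (Γ.t e), Finset.filter_filter,
    Finset.filter_filter]
  -- Edges that start below `c` without crossing it also end strictly below, as `c` is a regular
  -- value. Hence reversal is a fixed-point-free involution on them, and the terms cancel.
  have h2 : ∑ e with φ (Γ.i e) < c ∧ ¬ c < φ (Γ.t e),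
      (weightAt ι (A.χ e)).sign • A.fSharp T f e = 0 := by
    refine Finset.sum_involution (fun e _ => Γ.bar e)
      (fun e _ => sign_smul_fSharp_add_bar ι hw hA hx hf e) (fun e _ _ => Γ.bar_ne e)
      (fun e he => ?_) (fun e _ => Γ.bar_bar e)
    have ht : Γ.t (Γ.bar e) = Γ.i e := by rw [← Γ.i_bar, Γ.bar_bar]
    simp only [Finset.mem_filter, Finset.mem_univ, true_and, Γ.i_bar, ht, not_lt] at he ⊢
    exact ⟨lt_of_le_of_ne he.2 fun h => hc ⟨_, h⟩, he.1.le⟩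
  rw [h2, add_zero, reducedCharacter]
  refine Finset.sum_congr ?_ fun e he => ?_
  · ext e
    simp [OrientedGraph.reducedVertices, and_comm]
  · have he' := (Finset.mem_filter.1 he).2
    -- The moment map increases along a crossing edge, so its weight is positive and its sign is
    -- `1`.
    rw [hφ.sign_weightAt ι (he'.1.trans he'.2), one_smul]

end GraphAction

end GraphTorus

end

/-! ### Well-definedness of the local terms and integrality of the reduced character -/

theorem theorem1p5 {G : Type*} [CommGroup G] [TopologicalSpace G] [IsTopologicalGroup G]
    (n : ℕ) (hG : Nonempty (G ≃ₜ* (Fin n → Circle)))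
    {V E : Type*} [Finite V] [Fintype E] (Γ : GraphTorus.OrientedGraph V E) (d : ℕ)
    (A : GraphTorus.GraphAction G Γ d) (hA : A.IsGKM)
    (T : Subgroup G) (ι : Circle ≃ₜ* T) (hT : ∀ e, ¬ T ≤ A.stab e)
    (φ : V → ℝ) (hφ : A.IsMomentMap ι φ) (c : ℝ) (hc : c ∉ Set.range φ)
    (f : V → GraphTorus.RepRing G) (hf : f ∈ A.KRing) :
    (∀ e ∈ Γ.reducedVertices φ c,
      A.restrictDenoms e ≤ nonZeroDivisors (GraphTorus.RepRing (A.stab e)) ∧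
      Function.Surjective (A.proj T e) ∧ ((A.proj T e).toMonoidHom.ker : Set (A.stab e)).Finite ∧
      ∃ u v, GraphTorus.IsQuot (A.proj T e) (A.restrictQuot e (A.fHat f e)) u v) ∧
    ∃ F : GraphTorus.RepRing (G ⧸ T),
      algebraMap (GraphTorus.RepRing (G ⧸ T)) (FractionRing (GraphTorus.RepRing (G ⧸ T))) F =
        A.reducedCharacter T φ c f := by

  classical
  obtain ⟨σ⟩ := hG
  have : CompactSpace G := σ.symm.toHomeomorph.compactSpace
  have : Fintype V := Fintype.ofFinite V
  obtain ⟨x, hx⟩ := GraphTorus.exists_weightHom_eq ι σ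
  have hw := GraphTorus.GraphAction.weightAt_ne_zero ι hT
  have hS := GraphTorus.GraphAction.restrictDenoms_le_nonZeroDivisors ι hw hA
  refine ⟨fun e _ => ⟨hS e, GraphTorus.projSubgroup_ker_surjective ι (hw e),
    GraphTorus.finite_ker_projSubgroup_ker ι (hw e), ?_⟩, ?_⟩
  · obtain ⟨v, g, hg⟩ := GraphTorus.GraphAction.exists_common_denominator ι hw hA hx
      ⟨e, GraphTorus.OrientedGraph.mem_outEdges.2 rfl⟩
    exact ⟨_, v, (A.isQuot_and_fSharp_eq (hS e)
      (GraphTorus.projSubgroup_ker_surjective ι (hw e)) v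
      (GraphTorus.GraphAction.restrict_mul_eq_of_partialFractions hg _)).1⟩
  · choose F hF using GraphTorus.GraphAction.exists_algebraMap_eq_sum_outEdges ι hw hA hx f
    refine ⟨∑ p with φ p < c, F p, ?_⟩
    rw [GraphTorus.GraphAction.reducedCharacter_eq ι hw hA hx hφ hc hf, map_sum]
    exact Finset.sum_congr rfl fun p _ => hF p
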